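/- Let $\lambda_1,\lambda_2\in\mathbb{R}$ with $0<|\lambda_1|<1<|\lambda_2|$ and put $$\beta_0=\min\Big\{\frac{\log|\lambda_1|}{\log|\lambda_1|-\log|\lambda_2|},\ \frac{\log|\lambda_2|}{\log|\lambda_2|-\log|\lambda_1|}\Big\}>0 .$$ For $0<\beta\le 1$, a map is of class $C^{1,\beta}$ on an open set if it is $C^1$ there and its derivative is uniformly $\beta$-Hölder there (Lipschitz for $\beta=1$). A $C^{1,1}$ map $F:\mathbb{R}^2\to\mathbb{R}^2$ fixing the origin $O$ is called $C^{1,\beta}$-linearizable near $O$ if there are an open neighbourhood $U$ of $O$ and a homeomorphism $\Phi$ of $U$ onto an open subset of $\mathbb{R}^2$, with $\Phi$ and $\Phi^{-1}$ of class $C^{1,\beta}$, such that $\Phi(F(x))=DF(O)\,\Phi(x)$ for all $x\in U$ with $F(x)\in U$. (1) Let $F:\mathbb{R}^2\to\mathbb{R}^2$ be a $C^{1,1}$ map with $F(O)=O$ and $DF(O)=\mathrm{diag}(\lambda_1,\lambda_2)$. Then for every $\varepsilon\in(0,\beta_0)$ one has $\beta:=\beta_0-\varepsilon\in(0,1]$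 and $F$ is $C^{1,\beta}$-linearizable near $O$. (2) This exponent is sharp up to $\varepsilon$: for all such $\lambda_1,\lambda_2$ there is a $C^{1,1}$ map $F:\mathbb{R}^2\to\mathbb{R}^2$ with $F(O)=O$ and $DF(O)=\mathrm{diag}(\lambda_1,\lambda_2)$ that is not $C^{1,\beta}$-linearizable near $O$ for any $\beta$ with $\beta_0<\beta\le 1$. -/

import Mathlib

/-- `f` is of class `C^{1,β}` on the open set `s`: it is `C¹` on `s` and its derivative satisfies
a uniform Hölder condition with exponent `β` on `s` (for `β = 1`, a Lipschitz condition). -/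
def IsC1HolderOn {E G : Type*} [NormedAddCommGroup E] [NormedSpace ℝ E]
    [NormedAddCommGroup G] [NormedSpace ℝ G] (β : ℝ) (f : E → G) (s : Set E) : Prop :=
  ContDiffOn ℝ 1 f s ∧
    ∃ C : ℝ, ∀ x ∈ s, ∀ y ∈ s, ‖fderiv ℝ f x - fderiv ℝ f y‖ ≤ C * ‖x - y‖ ^ β

/-- `F` is `C^{1,β}` linearizable near its fixed point `0`: there is a `C^{1,β}` diffeomorphism `Φ`
from an open neighbourhood `U = Φ.source` of `0` onto an open set (so that `Φ` and its inverse are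
both of class `C^{1,β}`) with `Φ ∘ F = DF(0) ∘ Φ` wherever both sides are defined. -/
def IsC1HolderLinearizable {E : Type*} [NormedAddCommGroup E] [NormedSpace ℝ E]
    (β : ℝ) (F : E → E) : Prop :=
  ∃ Φ : OpenPartialHomeomorph E E,
    (0 : E) ∈ Φ.source ∧
    IsC1HolderOn β Φ Φ.source ∧
    IsC1HolderOn β Φ.symm Φ.target ∧
    ∀ x ∈ Φ.source, F x ∈ Φ.source → Φ (F x) = fderiv ℝ F 0 (Φ x)

/-- `F` is a planar map of class `C^{1,1}` fixing the origin `O`, with `DF(O) = diag(l₁, l₂)`. -/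
def IsPlanarC11WithDiag (l₁ l₂ : ℝ)
    (F : EuclideanSpace ℝ (Fin 2) → EuclideanSpace ℝ (Fin 2)) : Prop :=
  IsC1HolderOn 1 F Set.univ ∧ F 0 = 0 ∧
    HasFDerivAt F
      (Matrix.toEuclideanCLM (n := Fin 2) (𝕜 := ℝ) (Matrix.diagonal ![l₁, l₂])) 0

/-- The exponent `min {log|l₁| / (log|l₁| - log|l₂|), log|l₂| / (log|l₂| - log|l₁|)}`. -/
noncomputable def saddleExponent (l₁ l₂ : ℝ) : ℝ :=
  min (Real.log |l₁| / (Real.log |l₁| - Real.log |l₂|))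
    (Real.log |l₂| / (Real.log |l₂| - Real.log |l₁|))

/-!
# `C^{1,β}` linearization of planar saddles

Write `a`, `b` for the contracting and the expanding eigenvalue. A linearization amounts to two scalar
functions `φ₁`, `φ₂` of class `C^{1,β}` with independent derivatives at the origin such that
`φ₁ ∘ F = a φ₁` and `φ₂ ∘ F = b φ₂`. Passing to the inverse map exchanges the two equations, so it
suffices to solve `φ ∘ F = b φ`.

*Existence.* The method of successive approximations yields a `C^{1,1}` curve `γ` tangent to the
expanding direction with `F (γ t) = γ (b t)` (`exists_linearized_curve`). In coordinates adapted to
`γ`, and after a cut-off, `F` is a global small perturbation of its linear part, preserves the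
`y`-axis, and has the linear second component `b y` there. Then `φ = y + ∑ b ^ (-(n + 1)) e ∘ F^n`,
where `e` is the nonlinear part of the second component (`exists_solution_cohomological`). Since `e`
vanishes on the `y`-axis and the `x`-coordinate decays along orbits, the derivative of the `n`-th
term is `O(θ ^ n)` for each `θ > |a|`, while its Lipschitz constant is `O(M ^ n)` for each
`M > |b|`. Interpolating between the two bounds, the derivative of `φ` is `β`-Hölder as soon as
`|a| ^ (1 - β) |b| ^ β < 1`. This condition and its counterpart for the inverse map together say
that `β < saddleExponent a b`.

*Sharpness.* In the model `bumpSaddle` one coordinate is multiplied by its eigenvalue times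
`1 + h`, where `h = x² y² / (x² + y²) ^ (3/2)` vanishes on the axes, so that the map is linear there.
For any linearization of class `C^{1,β}`, the corresponding coordinate function `φ` is linear on one
axis, vanishes on the other and has constant transversal derivative there (`coordinate_estimates`).
Compare `φ` at both ends of an orbit segment of length `N` that runs from one axis to the other:
the accumulated factor `∏ (1 + h)` may differ from `1` only by an error of the order
`|a| ^ N + |b| ^ (-β N)` (or with `a⁻¹` and `b⁻¹` exchanged). But the orbit passes a point whose
coordinates are both of the order `exp (-(A B / (A + B)) N)`, `A = -log |a|`, `B = log |b|`, and so
is `h` there. Hence `β ≤ A / (A + B)`, respectively `β ≤ B / (A + B)`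
(`not_isC1HolderLinearizable_bumpSaddle`).
-/

open Metric Filter Topology

/-! ### Germs of class `C^{1,β}` -/

section Germs

variable {E G W : Type*} [NormedAddCommGroup E] [NormedSpace ℝ E]
  [NormedAddCommGroup G] [NormedSpace ℝ G] [NormedAddCommGroup W] [NormedSpace ℝ W]

theorem IsC1HolderOn.mono {β : ℝ} {f : E → G} {s t : Set E} (h : IsC1HolderOn β f s)
    (hts : t ⊆ s) : IsC1HolderOn β f t := by
  obtain ⟨h1, C, hC⟩ := h
  exact ⟨h1.mono hts, C, fun x hx y hy => hC x (hts hx) y (hts hy)⟩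

/-- A map with a Hölder continuous derivative on an open set is of class `C^{1,β}` there: the
continuity of the derivative is automatic. -/
theorem isC1HolderOn_of_hasFDerivAt {β C : ℝ} (hβ : 0 < β) {f : E → G} {f' : E → E →L[ℝ] G}
    {s : Set E} (hs : IsOpen s) (hf : ∀ x ∈ s, HasFDerivAt f (f' x) x)
    (hC : ∀ x ∈ s, ∀ y ∈ s, ‖f' x - f' y‖ ≤ C * ‖x - y‖ ^ β) : IsC1HolderOn β f s := by
  have hC' : ∀ x ∈ s, ∀ y ∈ s, ‖fderiv ℝ f x - fderiv ℝ f y‖ ≤ C * ‖x - y‖ ^ β := by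
    intro x hx y hy
    rw [(hf x hx).fderiv, (hf y hy).fderiv]
    exact hC x hx y hy
  refine ⟨?_, C, hC'⟩
  have h01 : (1 : WithTop ℕ∞) = 0 + 1 := by simp
  rw [h01, contDiffOn_succ_iff_fderiv_of_isOpen hs]
  refine ⟨fun x hx => (hf x hx).differentiableAt.differentiableWithinAt, by simp, ?_⟩
  rw [contDiffOn_zero]
  intro x hx
  rw [ContinuousWithinAt, tendsto_iff_norm_sub_tendsto_zero]
  have h0 : Tendsto (fun y => C * ‖y - x‖ ^ β) (𝓝[s] x) (𝓝 0) := by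
    have : ContinuousAt (fun y : E => C * ‖y - x‖ ^ β) x :=
      continuousAt_const.mul (ContinuousAt.rpow_const (by fun_prop) (Or.inr hβ.le))
    have h2 := this.tendsto.mono_left (nhdsWithin_le_nhds (s := s))
    simpa [Real.zero_rpow hβ.ne'] using h2
  exact squeeze_zero' (Eventually.of_forall fun _ => norm_nonneg _)
    (eventually_nhdsWithin_of_forall fun y hy => hC' y hy x hx) h0

/-- The germ of `f` at `x` is of class `C^{1,β}`. -/
def C1HolderAt (β : ℝ) (f : E → G) (x : E) : Prop :=
  ∃ r > 0, IsC1HolderOn β f (ball x r)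

/-- On a small ball, a germ of class `C^{1,β}` has a bounded Hölder derivative and is Lipschitz. -/
theorem C1HolderAt.exists_bounds {β : ℝ} (hβ : 0 < β) {f : E → G} {x : E}
    (hf : C1HolderAt β f x) : ∃ r > 0, ∃ C ≥ 0, ∃ M > 0,
      (∀ y ∈ ball x r, HasFDerivAt f (fderiv ℝ f y) y) ∧
      (∀ y ∈ ball x r, ‖fderiv ℝ f y‖ ≤ M) ∧
      (∀ y ∈ ball x r, ∀ z ∈ ball x r, ‖fderiv ℝ f y - fderiv ℝ f z‖ ≤ C * ‖y - z‖ ^ β) ∧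
      (∀ y ∈ ball x r, ∀ z ∈ ball x r, ‖f y - f z‖ ≤ M * ‖y - z‖) := by
  obtain ⟨r, hr, hd, C, hC⟩ := hf
  have hdiff : ∀ y ∈ ball x r, HasFDerivAt f (fderiv ℝ f y) y := fun y hy =>
    ((hd.differentiableOn one_ne_zero).differentiableAt (isOpen_ball.mem_nhds hy)).hasFDerivAt
  have hx : x ∈ ball x r := mem_ball_self hr
  have hbd : ∀ y ∈ ball x r, ‖fderiv ℝ f y‖ ≤ ‖fderiv ℝ f x‖ + |C| * r ^ β + 1 := by
    intro y hy
    have h1 := hC y hy x hx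
    have h2 : ‖y - x‖ ^ β ≤ r ^ β :=
      Real.rpow_le_rpow (norm_nonneg _) (mem_ball_iff_norm.1 hy).le hβ.le
    have h3 : C * ‖y - x‖ ^ β ≤ |C| * r ^ β :=
      mul_le_mul (le_abs_self C) h2 (by positivity) (abs_nonneg C)
    have h4 := norm_sub_norm_le (fderiv ℝ f y) (fderiv ℝ f x)
    linarith
  refine ⟨r, hr, |C|, abs_nonneg C, ‖fderiv ℝ f x‖ + |C| * r ^ β + 1, by positivity, hdiff, hbd,
    ?_, ?_⟩
  · intro y hy z hz
    exact (hC y hy z hz).trans (mul_le_mul_of_nonneg_right (le_abs_self C) (by positivity))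
  · intro y hy z hz
    exact Convex.norm_image_sub_le_of_norm_hasFDerivWithin_le
      (fun w hw => (hdiff w hw).hasFDerivWithinAt) hbd (convex_ball x r) hz hy

theorem C1HolderAt.hasFDerivAt {β : ℝ} (hβ : 0 < β) {f : E → G} {x : E}
    (hf : C1HolderAt β f x) : HasFDerivAt f (fderiv ℝ f x) x := by
  obtain ⟨r, hr, C, -, M, -, h, -⟩ := hf.exists_bounds hβ
  exact h x (mem_ball_self hr)

/-- A Lipschitz derivative is `β`-Hölder on balls of diameter at most `1`. -/
theorem C1HolderAt.of_one {β : ℝ} (hβ1 : β ≤ 1) {f : E → G} {x : E}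
    (hf : C1HolderAt 1 f x) : C1HolderAt β f x := by
  obtain ⟨r, hr, hd, C, hC⟩ := hf
  refine ⟨min r (1 / 2), by positivity, hd.mono (ball_subset_ball (min_le_left _ _)), |C|, ?_⟩
  intro y hy z hz
  have h1 := hC y (ball_subset_ball (min_le_left _ _) hy) z (ball_subset_ball (min_le_left _ _) hz)
  have hy2 := mem_ball_iff_norm.1 (ball_subset_ball (min_le_right _ _) hy)
  have hz2 := mem_ball_iff_norm.1 (ball_subset_ball (min_le_right _ _) hz)
  have h2 : ‖y - z‖ ≤ 1 := by
    have := norm_sub_le (y - x) (z - x)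
    rw [sub_sub_sub_cancel_right] at this
    linarith
  rw [Real.rpow_one] at h1
  have h3 : ‖y - z‖ ≤ ‖y - z‖ ^ β := by
    rcases (norm_nonneg (y - z)).eq_or_lt with h0 | h0
    · rw [← h0]; exact Real.rpow_nonneg le_rfl _
    · simpa using Real.rpow_le_rpow_of_exponent_ge h0 h2 hβ1
  calc _ ≤ C * ‖y - z‖ := h1
    _ ≤ |C| * ‖y - z‖ := mul_le_mul_of_nonneg_right (le_abs_self C) (norm_nonneg _)
    _ ≤ |C| * ‖y - z‖ ^ β := mul_le_mul_of_nonneg_left h3 (abs_nonneg C)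

theorem ContinuousLinearMap.c1HolderAt (L : E →L[ℝ] G) {β : ℝ} (hβ : 0 < β) (x : E) :
    C1HolderAt β L x :=
  ⟨1, one_pos, isC1HolderOn_of_hasFDerivAt (C := 0) (f' := fun _ => L) hβ isOpen_ball
    (fun y _ => L.hasFDerivAt) (by simp)⟩

theorem C1HolderAt.comp {β : ℝ} (hβ : 0 < β) {g : G → W} {f : E → G} {x : E}
    (hg : C1HolderAt β g (f x)) (hf : C1HolderAt β f x) : C1HolderAt β (fun y => g (f y)) x := by
  obtain ⟨r, hr, C, hC, M, hM, hd, hb, hh, hl⟩ := hf.exists_bounds hβ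
  obtain ⟨r', hr', C', hC', M', hM', hd', hb', hh', hl'⟩ := hg.exists_bounds hβ
  have hmaps : ∀ y ∈ ball x (min r (r' / M)), y ∈ ball x r ∧ f y ∈ ball (f x) r' := by
    intro y hy
    have h1 : y ∈ ball x r := ball_subset_ball (min_le_left _ _) hy
    refine ⟨h1, mem_ball_iff_norm.2 ?_⟩
    have h2 := mem_ball_iff_norm.1 (ball_subset_ball (min_le_right _ _) hy)
    rw [lt_div_iff₀ hM] at h2
    have h3 := hl y h1 x (mem_ball_self hr)
    linarith
  refine ⟨min r (r' / M), by positivity, ?_⟩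
  refine isC1HolderOn_of_hasFDerivAt (C := C' * M ^ β * M + M' * C)
    (f' := fun y => (fderiv ℝ g (f y)).comp (fderiv ℝ f y)) hβ isOpen_ball ?_ ?_
  · intro y hy
    obtain ⟨h1, h2⟩ := hmaps y hy
    exact (hd' _ h2).comp y (hd y h1)
  · intro y hy z hz
    obtain ⟨hy1, hy2⟩ := hmaps y hy
    obtain ⟨hz1, hz2⟩ := hmaps z hz
    have key : (fderiv ℝ g (f y)).comp (fderiv ℝ f y) - (fderiv ℝ g (f z)).comp (fderiv ℝ f z)
        = (fderiv ℝ g (f y) - fderiv ℝ g (f z)).comp (fderiv ℝ f y)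
          + (fderiv ℝ g (f z)).comp (fderiv ℝ f y - fderiv ℝ f z) := by
      ext v; simp
    rw [key]
    have h1 : ‖f y - f z‖ ^ β ≤ M ^ β * ‖y - z‖ ^ β := by
      rw [← Real.mul_rpow hM.le (norm_nonneg _)]
      exact Real.rpow_le_rpow (norm_nonneg _) (hl y hy1 z hz1) hβ.le
    have h2 : ‖fderiv ℝ g (f y) - fderiv ℝ g (f z)‖ ≤ C' * (M ^ β * ‖y - z‖ ^ β) :=
      (hh' _ hy2 _ hz2).trans (mul_le_mul_of_nonneg_left h1 hC')
    calc _ ≤ ‖(fderiv ℝ g (f y) - fderiv ℝ g (f z)).comp (fderiv ℝ f y)‖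
          + ‖(fderiv ℝ g (f z)).comp (fderiv ℝ f y - fderiv ℝ f z)‖ := norm_add_le _ _
      _ ≤ ‖fderiv ℝ g (f y) - fderiv ℝ g (f z)‖ * ‖fderiv ℝ f y‖
          + ‖fderiv ℝ g (f z)‖ * ‖fderiv ℝ f y - fderiv ℝ f z‖ :=
        add_le_add (ContinuousLinearMap.opNorm_comp_le _ _)
          (ContinuousLinearMap.opNorm_comp_le _ _)
      _ ≤ C' * (M ^ β * ‖y - z‖ ^ β) * M + M' * (C * ‖y - z‖ ^ β) := by
        refine add_le_add (mul_le_mul h2 (hb y hy1) (norm_nonneg _) (by positivity))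
          (mul_le_mul (hb' _ hz2) (hh y hy1 z hz1) (norm_nonneg _) hM'.le)
      _ = _ := by ring

theorem C1HolderAt.add {β : ℝ} (hβ : 0 < β) {f g : E → G} {x : E}
    (hf : C1HolderAt β f x) (hg : C1HolderAt β g x) : C1HolderAt β (fun y => f y + g y) x := by
  obtain ⟨r, hr, C, hC, M, hM, hd, hb, hh, hl⟩ := hf.exists_bounds hβ
  obtain ⟨r', hr', C', hC', M', hM', hd', hb', hh', hl'⟩ := hg.exists_bounds hβ
  have hs : ball x (min r r') ⊆ ball x r := ball_subset_ball (min_le_left _ _)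
  have hs' : ball x (min r r') ⊆ ball x r' := ball_subset_ball (min_le_right _ _)
  refine ⟨min r r', lt_min hr hr', isC1HolderOn_of_hasFDerivAt (C := C + C')
    (f' := fun y => fderiv ℝ f y + fderiv ℝ g y) hβ isOpen_ball
    (fun y hy => (hd y (hs hy)).add (hd' y (hs' hy))) ?_⟩
  intro y hy z hz
  have h1 := hh y (hs hy) z (hs hz)
  have h2 := hh' y (hs' hy) z (hs' hz)
  rw [add_sub_add_comm]
  exact (norm_add_le _ _).trans (by linarith)

/-- A `C^{1,β}` germ with invertible derivative restricts to a `C^{1,β}` diffeomorphism with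
`C^{1,β}` inverse. -/
theorem C1HolderAt.exists_openPartialHomeomorph [CompleteSpace E] {β : ℝ} (hβ : 0 < β)
    {f : E → E} {x : E} {A : E ≃L[ℝ] E} (hf : C1HolderAt β f x)
    (hA : HasFDerivAt f (A : E →L[ℝ] E) x) {s : Set E} (hs : s ∈ 𝓝 x) :
    ∃ Φ : OpenPartialHomeomorph E E, x ∈ Φ.source ∧ Φ.source ⊆ s ∧ (∀ y, Φ y = f y) ∧
      IsC1HolderOn β Φ Φ.source ∧ IsC1HolderOn β Φ.symm Φ.target := by
  obtain ⟨r₀, hr₀, hf₀⟩ := id hf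
  obtain ⟨r, hr, C, hC, M, hM, hd, hb, hh, hl⟩ := hf.exists_bounds hβ
  have hcd : ContDiffAt ℝ 1 f x := hf₀.1.contDiffAt (ball_mem_nhds x hr₀)
  have hstrict : HasStrictFDerivAt f (A : E →L[ℝ] E) x := hcd.hasStrictFDerivAt' hA one_ne_zero
  have hcont : ContinuousAt (fderiv ℝ f) x := hcd.continuousAt_fderiv one_ne_zero
  have hfx : fderiv ℝ f x = A := hA.fderiv
  -- Near `A` every operator is invertible, and inversion is Lipschitz and bounded.
  obtain ⟨K, t, ht, hK⟩ := (contDiffAt_map_inverse (𝕜 := ℝ) (n := 1) A).exists_lipschitzOnWith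
  have hbdd : ∀ᶠ B : E →L[ℝ] E in 𝓝 (A : E →L[ℝ] E),
      ‖ContinuousLinearMap.inverse B‖ < ‖ContinuousLinearMap.inverse (A : E →L[ℝ] E)‖ + 1 :=
    (contDiffAt_map_inverse (𝕜 := ℝ) (n := 1) A).continuousAt.norm.eventually_lt
      continuousAt_const (by simp)
  set N := ‖ContinuousLinearMap.inverse (A : E →L[ℝ] E)‖ + 1 with hN
  have hev : ∀ᶠ y in 𝓝 x, (fderiv ℝ f y ∈ t ∧ (∃ B : E ≃L[ℝ] E, (B : E →L[ℝ] E) = fderiv ℝ f y) ∧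
      ‖ContinuousLinearMap.inverse (fderiv ℝ f y)‖ < N) ∧ y ∈ s ∧ y ∈ ball x r ∧ y ∈ ball x r₀ := by
    have h1 : ∀ᶠ B : E →L[ℝ] E in 𝓝 (fderiv ℝ f x), B ∈ t ∧
        (∃ B' : E ≃L[ℝ] E, (B' : E →L[ℝ] E) = B) ∧ ‖ContinuousLinearMap.inverse B‖ < N := by
      rw [hfx]
      filter_upwards [ht, A.nhds, hbdd] with B h1 h2 h3 using ⟨h1, h2, h3⟩
    filter_upwards [hcont.eventually h1, hs, ball_mem_nhds x hr, ball_mem_nhds x hr₀]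
      with y h1 h2 h3 h4 using ⟨h1, h2, h3, h4⟩
  obtain ⟨ρ, hρ, hball⟩ := Metric.eventually_nhds_iff_ball.1 hev
  let Φ₁ := (hstrict.toOpenPartialHomeomorph f).restrOpen (ball x ρ) isOpen_ball
  have hxΦ₁ : x ∈ Φ₁.source := ⟨hstrict.mem_toOpenPartialHomeomorph_source, mem_ball_self hρ⟩
  have hΦ₁ : ∀ y, Φ₁ y = f y := fun y => rfl
  have hfxt : f x ∈ Φ₁.target := Φ₁.map_source hxΦ₁
  -- The target is shrunk to a ball, on which the mean value inequality applies to the inverse.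
  obtain ⟨δ, hδ, hδt⟩ := Metric.isOpen_iff.1 Φ₁.open_target (f x) hfxt
  let Φ := (Φ₁.symm.restrOpen (ball (f x) δ) isOpen_ball).symm
  have hΦ : ∀ y, Φ y = f y := fun y => rfl
  have hsource : ∀ y ∈ Φ.source, y ∈ Φ₁.source := by
    intro y hy
    have h1 : Φ.symm (Φ y) ∈ Φ.source := Φ.symm.map_source (Φ.map_source hy)
    have hy' : y = Φ₁.symm (Φ y) := (Φ.left_inv hy).symm
    have h2 : Φ y ∈ Φ₁.target := (Φ.map_source hy).1
    rw [hy']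
    exact Φ₁.map_target h2
  have htarget : Φ.target = ball (f x) δ := by
    change Φ₁.target ∩ ball (f x) δ = ball (f x) δ
    exact Set.inter_eq_right.2 hδt
  have hsball : ∀ y ∈ Φ.source, y ∈ ball x ρ := fun y hy => (hsource y hy).2
  have hxs : x ∈ Φ.source := by
    have h1 : f x ∈ Φ.target := by rw [htarget]; exact mem_ball_self hδ
    have h2 : Φ.symm (f x) = x := Φ₁.left_inv hxΦ₁
    rw [← h2]
    exact Φ.map_target h1
  have hderiv : ∀ w ∈ Φ.target, HasFDerivAt Φ.symm
      (ContinuousLinearMap.inverse (fderiv ℝ f (Φ.symm w))) w := by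
    intro w hw
    have hy := hsball _ (Φ.map_target hw)
    obtain ⟨B, hB⟩ := (hball _ hy).1.2.1
    have h1 : HasFDerivAt f (B : E →L[ℝ] E) (Φ.symm w) := by
      rw [hB]; exact hd _ (hball _ hy).2.2.1
    have h2 := Φ.hasFDerivAt_symm hw h1
    rwa [← hB, ContinuousLinearMap.inverse_equiv]
  have hN0 : 0 < N := by positivity
  have hlip : ∀ w ∈ Φ.target, ∀ w' ∈ Φ.target, ‖Φ.symm w - Φ.symm w'‖ ≤ N * ‖w - w'‖ := by
    intro w hw w' hw'
    rw [htarget] at hw hw'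
    refine Convex.norm_image_sub_le_of_norm_hasFDerivWithin_le (s := ball (f x) δ)
      (fun v hv => (hderiv v (htarget ▸ hv)).hasFDerivWithinAt) (fun v hv => ?_)
      (convex_ball _ _) hw' hw
    exact (hball _ (hsball _ (Φ.map_target (htarget ▸ hv)))).1.2.2.le
  refine ⟨Φ, hxs, fun y hy => (hball y (hsball y hy)).2.1, hΦ,
    hf₀.mono fun y hy => (hball y (hsball y hy)).2.2.2, ?_⟩
  refine isC1HolderOn_of_hasFDerivAt (C := K * (C * N ^ β)) hβ Φ.open_target hderiv ?_
  intro w hw w' hw'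
  have hy := hball _ (hsball _ (Φ.map_target hw))
  have hy' := hball _ (hsball _ (Φ.map_target hw'))
  have h1 := hK.dist_le_mul _ hy.1.1 _ hy'.1.1
  rw [dist_eq_norm, dist_eq_norm] at h1
  have h2 := hh _ hy.2.2.1 _ hy'.2.2.1
  have h3 : ‖Φ.symm w - Φ.symm w'‖ ^ β ≤ N ^ β * ‖w - w'‖ ^ β := by
    rw [← Real.mul_rpow hN0.le (norm_nonneg _)]
    exact Real.rpow_le_rpow (norm_nonneg _) (hlip w hw w' hw') hβ.le
  calc _ ≤ K * ‖fderiv ℝ f (Φ.symm w) - fderiv ℝ f (Φ.symm w')‖ := h1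
    _ ≤ K * (C * (N ^ β * ‖w - w'‖ ^ β)) := by gcongr; exact h2.trans (by gcongr)
    _ = _ := by ring

/-- The local inverse of a `C^{1,β}` germ with invertible derivative, as a germ. -/
theorem C1HolderAt.exists_inverse [CompleteSpace E] {β : ℝ} (hβ : 0 < β)
    {f : E → E} {x : E} {A : E ≃L[ℝ] E} (hf : C1HolderAt β f x)
    (hA : HasFDerivAt f (A : E →L[ℝ] E) x) :
    ∃ g : E → E, C1HolderAt β g (f x) ∧ g (f x) = x ∧
      HasFDerivAt g (A.symm : E →L[ℝ] E) (f x) ∧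
      (∀ᶠ y in 𝓝 x, g (f y) = y) ∧ ∀ᶠ w in 𝓝 (f x), f (g w) = w := by
  obtain ⟨Φ, hx, -, hΦ, -, hsymm⟩ := hf.exists_openPartialHomeomorph hβ hA univ_mem
  have hfx : f x ∈ Φ.target := hΦ x ▸ Φ.map_source hx
  obtain ⟨r, hr, hrt⟩ := Metric.isOpen_iff.1 Φ.open_target _ hfx
  have hleft : ∀ y ∈ Φ.source, Φ.symm (f y) = y := fun y hy => hΦ y ▸ Φ.left_inv hy
  refine ⟨Φ.symm, ⟨r, hr, hsymm.mono hrt⟩, hleft x hx, ?_, ?_, ?_⟩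
  · refine Φ.hasFDerivAt_symm hfx ?_
    rw [hleft x hx]
    exact hA.congr_of_eventuallyEq (Eventually.of_forall hΦ)
  · filter_upwards [Φ.open_source.mem_nhds hx] with y hy using hleft y hy
  · filter_upwards [Φ.open_target.mem_nhds hfx] with w hw
    rw [← hΦ]; exact Φ.right_inv hw

end Germs

/-! ### Cutting off a germ -/

/-- A `C^{1,1}` germ that vanishes to second order extends to a global `C^{1,1}` map with
arbitrarily small derivative. The extension is `f ∘ ρ` for a smooth map `ρ` which is the identity
near `0`, has image in a small ball, and moves each point along its ray; hence the extension
vanishes on every line through the origin along which `f` vanishes. -/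
theorem C1HolderAt.exists_cutoff {E G : Type*} [NormedAddCommGroup E] [NormedSpace ℝ E]
    [FiniteDimensional ℝ E] [NormedAddCommGroup G] [NormedSpace ℝ G] {f : E → G}
    (hf : C1HolderAt 1 f 0) (hf0 : fderiv ℝ f 0 = 0) {η δ : ℝ} (hη : 0 < η) (hδ : 0 < δ) :
    ∃ (g : E → G) (g' : E → E →L[ℝ] G) (K : ℝ), 0 ≤ K ∧ (∀ z, HasFDerivAt g (g' z) z) ∧
      (∀ z, ‖g' z‖ ≤ η) ∧ (∀ z w, ‖g' z - g' w‖ ≤ K * ‖z - w‖) ∧ g =ᶠ[𝓝 0] f ∧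
      ∀ z, ∃ s : ℝ, ‖s • z‖ < δ ∧ g z = f (s • z) := by
  obtain ⟨r, hr, C, hC, M, hM, hd, hb, hh, hl⟩ := hf.exists_bounds one_pos
  simp only [Real.rpow_one] at hh
  let χ : ContDiffBump (0 : E) := ⟨1, 2, one_pos, one_lt_two⟩
  let R : E → E := fun z => χ z • z
  have hRs : ContDiff ℝ 2 R := χ.contDiff.smul contDiff_id
  have hRc : HasCompactSupport R := χ.hasCompactSupport.smul_right
  obtain ⟨R₁, hR₁⟩ := hRs.lipschitzWith_of_hasCompactSupport hRc two_ne_zero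
  have hRs' : ContDiff ℝ 1 (fderiv ℝ R) := hRs.fderiv_right (by norm_num)
  obtain ⟨R₂, hR₂⟩ := hRs'.lipschitzWith_of_hasCompactSupport (hRc.fderiv (𝕜 := ℝ)) one_ne_zero
  have hRd : ∀ z, HasFDerivAt R (fderiv ℝ R z) z := fun z =>
    (hRs.differentiable two_ne_zero z).hasFDerivAt
  have hRb : ∀ z, ‖fderiv ℝ R z‖ ≤ R₁ := fun z => norm_fderiv_le_of_lipschitz ℝ hR₁
  have hRn : ∀ z, ‖R z‖ ≤ 2 := by
    intro z
    by_cases hz : z ∈ ball (0 : E) 2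
    · rw [norm_smul, Real.norm_of_nonneg χ.nonneg]
      have h1 := mem_ball_zero_iff.1 hz
      have h2 : χ z ≤ 1 := χ.le_one
      nlinarith [norm_nonneg z, χ.nonneg (x := z)]
    · have h0 : χ z = 0 := by
        apply χ.zero_of_le_dist
        simpa [mem_ball] using hz
      simp [R, h0]
  obtain ⟨ρ, hρ, hρr, hρδ, hρη⟩ : ∃ ρ > 0, ρ * 2 < r ∧ ρ * 2 < δ ∧ C * (ρ * 2) * R₁ ≤ η := by
    have h1 : Tendsto (fun ρ : ℝ => ρ * 2) (𝓝[>] 0) (𝓝 0) := by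
      have : ContinuousAt (fun ρ : ℝ => ρ * 2) 0 := by fun_prop
      simpa using this.tendsto.mono_left (nhdsWithin_le_nhds (s := Set.Ioi 0))
    have h2 : Tendsto (fun ρ : ℝ => C * (ρ * 2) * R₁) (𝓝[>] 0) (𝓝 0) := by
      have : ContinuousAt (fun ρ : ℝ => C * (ρ * 2) * R₁) 0 := by fun_prop
      simpa using this.tendsto.mono_left (nhdsWithin_le_nhds (s := Set.Ioi 0))
    obtain ⟨ρ, ha, hb, hc, hd⟩ := ((h1.eventually_lt_const hr).and ((h1.eventually_lt_const hδ).and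
      ((h2.eventually_le_const hη).and self_mem_nhdsWithin))).exists
    exact ⟨ρ, hd, ha, hb, hc⟩
  let P : E → E := fun z => ρ • R (ρ⁻¹ • z)
  have hPn : ∀ z, ‖P z‖ ≤ ρ * 2 := by
    intro z
    rw [norm_smul, Real.norm_of_nonneg hρ.le]
    exact mul_le_mul_of_nonneg_left (hRn _) hρ.le
  have hPd : ∀ z, HasFDerivAt P (fderiv ℝ R (ρ⁻¹ • z)) z := by
    intro z
    have h1 : HasFDerivAt (fun z : E => ρ⁻¹ • z) (ρ⁻¹ • ContinuousLinearMap.id ℝ E) z :=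
      (hasFDerivAt_id z).const_smul ρ⁻¹
    have h2 := ((hRd (ρ⁻¹ • z)).comp z h1).const_smul ρ
    refine h2.congr_fderiv ?_
    ext v
    simp [smul_smul, hρ.ne']
  have hPr : ∀ z, P z ∈ ball (0 : E) r := fun z => mem_ball_zero_iff.2 ((hPn z).trans_lt hρr)
  have hPe : ∀ z, P z = χ (ρ⁻¹ • z) • z := by
    intro z
    simp only [P, R, smul_smul]
    congr 1
    field_simp
  have h0 : (0 : E) ∈ ball (0 : E) r := mem_ball_self hr
  have hfn : ∀ z, ‖fderiv ℝ f (P z)‖ ≤ C * (ρ * 2) := by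
    intro z
    have := hh _ (hPr z) 0 h0
    rw [hf0, sub_zero, sub_zero] at this
    exact this.trans (mul_le_mul_of_nonneg_left (hPn z) hC)
  have hPl : ∀ z w, ‖P z - P w‖ ≤ R₁ * ‖z - w‖ := fun z w =>
    Convex.norm_image_sub_le_of_norm_hasFDerivWithin_le (s := Set.univ)
      (fun v _ => (hPd v).hasFDerivWithinAt) (fun v _ => hRb _) convex_univ trivial trivial
  refine ⟨fun z => f (P z), fun z => (fderiv ℝ f (P z)).comp (fderiv ℝ R (ρ⁻¹ • z)),
    C * R₁ * R₁ + C * (ρ * 2) * (R₂ * ρ⁻¹), by positivity, fun z => (hd _ (hPr z)).comp z (hPd z),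
    fun z => ?_, fun z w => ?_, ?_, fun z => ?_⟩
  · exact (ContinuousLinearMap.opNorm_comp_le _ _).trans
      ((mul_le_mul (hfn z) (hRb _) (norm_nonneg _) (by positivity)).trans hρη)
  · have key : (fderiv ℝ f (P z)).comp (fderiv ℝ R (ρ⁻¹ • z))
        - (fderiv ℝ f (P w)).comp (fderiv ℝ R (ρ⁻¹ • w))
        = (fderiv ℝ f (P z) - fderiv ℝ f (P w)).comp (fderiv ℝ R (ρ⁻¹ • z))
          + (fderiv ℝ f (P w)).comp (fderiv ℝ R (ρ⁻¹ • z) - fderiv ℝ R (ρ⁻¹ • w)) := by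
      ext v; simp
    have h1 : ‖fderiv ℝ f (P z) - fderiv ℝ f (P w)‖ ≤ C * (R₁ * ‖z - w‖) :=
      (hh _ (hPr z) _ (hPr w)).trans (mul_le_mul_of_nonneg_left (hPl z w) hC)
    have h2 : ‖fderiv ℝ R (ρ⁻¹ • z) - fderiv ℝ R (ρ⁻¹ • w)‖ ≤ R₂ * (ρ⁻¹ * ‖z - w‖) := by
      have := hR₂.dist_le_mul (ρ⁻¹ • z) (ρ⁻¹ • w)
      rwa [dist_eq_norm, dist_eq_norm, ← smul_sub, norm_smul,
        Real.norm_of_nonneg (inv_nonneg.2 hρ.le)] at this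
    rw [key]
    calc _ ≤ _ := norm_add_le _ _
      _ ≤ _ := add_le_add (ContinuousLinearMap.opNorm_comp_le _ _)
          (ContinuousLinearMap.opNorm_comp_le _ _)
      _ ≤ C * (R₁ * ‖z - w‖) * R₁ + C * (ρ * 2) * (R₂ * (ρ⁻¹ * ‖z - w‖)) :=
        add_le_add (mul_le_mul h1 (hRb _) (norm_nonneg _) (by positivity))
          (mul_le_mul (hfn w) h2 (norm_nonneg _) (by positivity))
      _ = _ := by ring
  · have : ∀ᶠ z : E in 𝓝 0, ρ⁻¹ • z ∈ closedBall (0 : E) 1 := by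
      have h1 : ContinuousAt (fun z : E => ρ⁻¹ • z) 0 := by fun_prop
      apply h1.eventually
      simp only [smul_zero]
      exact closedBall_mem_nhds (0 : E) one_pos
    filter_upwards [this] with z hz
    rw [hPe, χ.one_of_mem_closedBall hz, one_smul]
  · exact ⟨χ (ρ⁻¹ • z), hPe z ▸ (hPn z).trans_lt hρδ, by rw [← hPe]⟩

/-! ### The linearizing function as a telescoping series -/

section Series

variable {E : Type*} [NormedAddCommGroup E] [NormedSpace ℝ E]

/-- The derivative of the `n`-th iterate of a map with derivative `F'`, by the chain rule. -/
def iterateFDeriv (F : E → E) (F' : E → E →L[ℝ] E) : ℕ → E → E →L[ℝ] E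
  | 0, _ => ContinuousLinearMap.id ℝ E
  | n + 1, z => (F' (F^[n] z)).comp (iterateFDeriv F F' n z)

variable {F : E → E} {F' : E → E →L[ℝ] E} {M K : ℝ}

theorem hasFDerivAt_iterate (hF : ∀ z, HasFDerivAt F (F' z) z) (n : ℕ) (z : E) :
    HasFDerivAt F^[n] (iterateFDeriv F F' n z) z := by
  induction n with
  | zero => exact hasFDerivAt_id z
  | succ n ih =>
    rw [Function.iterate_succ']
    exact (hF _).comp z ih

theorem norm_iterateFDeriv_le (hM : 0 ≤ M) (hF : ∀ z, ‖F' z‖ ≤ M) (n : ℕ) (z : E) :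
    ‖iterateFDeriv F F' n z‖ ≤ M ^ n := by
  induction n with
  | zero => simpa [iterateFDeriv] using ContinuousLinearMap.norm_id_le
  | succ n ih =>
    rw [pow_succ']
    exact (ContinuousLinearMap.opNorm_comp_le _ _).trans
      (mul_le_mul (hF _) ih (norm_nonneg _) hM)

theorem norm_iterate_sub_le (hM : 0 ≤ M) (hF : ∀ z, HasFDerivAt F (F' z) z)
    (hFM : ∀ z, ‖F' z‖ ≤ M) (n : ℕ) (z w : E) : ‖F^[n] z - F^[n] w‖ ≤ M ^ n * ‖z - w‖ :=
  Convex.norm_image_sub_le_of_norm_hasFDerivWithin_le (s := Set.univ)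
    (fun v _ => (hasFDerivAt_iterate hF n v).hasFDerivWithinAt)
    (fun v _ => norm_iterateFDeriv_le hM hFM n v) convex_univ trivial trivial

/-- The Lipschitz constant of the derivative of the `n`-th iterate grows like `M ^ (2 * n)`. -/
theorem norm_iterateFDeriv_sub_le (hM : 1 < M) (hK : 0 ≤ K)
    (hF : ∀ z, HasFDerivAt F (F' z) z) (hFM : ∀ z, ‖F' z‖ ≤ M)
    (hFK : ∀ z w, ‖F' z - F' w‖ ≤ K * ‖z - w‖) (n : ℕ) (z w : E) :
    ‖iterateFDeriv F F' n z - iterateFDeriv F F' n w‖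
      ≤ K / (M ^ 2 - M) * (M ^ 2) ^ n * ‖z - w‖ := by
  have hM0 : 0 < M := one_pos.trans hM
  have hMM : 0 < M ^ 2 - M := by nlinarith
  induction n with
  | zero => simp only [iterateFDeriv, sub_self, norm_zero]; positivity
  | succ n ih =>
    have key : iterateFDeriv F F' (n + 1) z - iterateFDeriv F F' (n + 1) w
        = (F' (F^[n] z) - F' (F^[n] w)).comp (iterateFDeriv F F' n z)
          + (F' (F^[n] w)).comp (iterateFDeriv F F' n z - iterateFDeriv F F' n w) := by
      ext v; simp [iterateFDeriv]
    have h1 : ‖F' (F^[n] z) - F' (F^[n] w)‖ ≤ K * (M ^ n * ‖z - w‖) :=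
      (hFK _ _).trans (mul_le_mul_of_nonneg_left (norm_iterate_sub_le hM0.le hF hFM n z w) hK)
    rw [key]
    calc _ ≤ _ := norm_add_le _ _
      _ ≤ _ := add_le_add (ContinuousLinearMap.opNorm_comp_le _ _)
          (ContinuousLinearMap.opNorm_comp_le _ _)
      _ ≤ K * (M ^ n * ‖z - w‖) * M ^ n
          + M * (K / (M ^ 2 - M) * (M ^ 2) ^ n * ‖z - w‖) :=
        add_le_add (mul_le_mul h1 (norm_iterateFDeriv_le hM0.le hFM n z) (norm_nonneg _)
          (by positivity)) (mul_le_mul (hFM _) ih (norm_nonneg _) hM0.le)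
      _ = _ := by
        have h2 : (M ^ 2) ^ n = M ^ n * M ^ n := by ring
        have hM1 : M - 1 ≠ 0 := sub_ne_zero.2 hM.ne'
        rw [pow_succ (M ^ 2), h2]
        field_simp
        ring

/-- The derivative of the iterates contracts the coordinate `p` up to the factor `M ^ n`: the
coupling to the other directions is proportional to `p z`, which decays along orbits. -/
theorem abs_apply_iterateFDeriv_le {p : E →L[ℝ] ℝ} {θ : ℝ} (hM : 1 < M) (hθ : 0 < θ)
    (hK : 0 ≤ K) (hFM : ∀ z, ‖F' z‖ ≤ M) (hpF : ∀ z, |p (F z)| ≤ θ * |p z|)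
    (hpF' : ∀ z v, |p (F' z v)| ≤ θ * |p v| + K * |p z| * ‖v‖) {z : E} (hz : |p z| < 1)
    (n : ℕ) (v : E) :
    |p (F^[n] z)| ≤ θ ^ n ∧
      |p (iterateFDeriv F F' n z v)| ≤ (‖p‖ + K / (θ * (M - 1))) * (θ * M) ^ n * ‖v‖ := by
  have hM0 : 0 < M := one_pos.trans hM
  have hM1 : 0 < M - 1 := sub_pos.2 hM
  induction n with
  | zero =>
    refine ⟨by simpa using hz.le, ?_⟩
    have h1 := p.le_opNorm v
    rw [Real.norm_eq_abs] at h1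
    have h2 : 0 ≤ K / (θ * (M - 1)) * ‖v‖ := by positivity
    simp only [iterateFDeriv, ContinuousLinearMap.id_apply, pow_zero, mul_one]
    linarith
  | succ n ih =>
    obtain ⟨ih1, ih2⟩ := ih
    constructor
    · rw [Function.iterate_succ_apply', pow_succ']
      exact (hpF _).trans (mul_le_mul_of_nonneg_left ih1 hθ.le)
    · have h1 : ‖iterateFDeriv F F' n z v‖ ≤ M ^ n * ‖v‖ :=
        (ContinuousLinearMap.le_opNorm _ _).trans
          (mul_le_mul_of_nonneg_right (norm_iterateFDeriv_le hM0.le hFM n z) (norm_nonneg _))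
      calc |p (F' (F^[n] z) (iterateFDeriv F F' n z v))|
          ≤ θ * |p (iterateFDeriv F F' n z v)| + K * |p (F^[n] z)| * ‖iterateFDeriv F F' n z v‖ :=
            hpF' _ _
        _ ≤ θ * ((‖p‖ + K / (θ * (M - 1))) * (θ * M) ^ n * ‖v‖) + K * θ ^ n * (M ^ n * ‖v‖) := by
            gcongr
        _ = (θ * ‖p‖ + K / (M - 1) + K) * (θ * M) ^ n * ‖v‖ := by
            rw [mul_pow]; field_simp
        _ ≤ (θ * M * ‖p‖ + K / (M - 1) + K) * (θ * M) ^ n * ‖v‖ := by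
            gcongr
            nlinarith
        _ = _ := by
            rw [pow_succ]
            field_simp
            ring

theorem le_rpow_mul_rpow {x a b β : ℝ} (hx : 0 ≤ x) (ha : x ≤ a) (hb : x ≤ b) (hβ0 : 0 ≤ β)
    (hβ1 : β ≤ 1) : x ≤ a ^ (1 - β) * b ^ β := by
  calc x = x ^ (1 - β) * x ^ β := by
        rw [← Real.rpow_add_of_nonneg hx (by linarith) hβ0]; simp
    _ ≤ a ^ (1 - β) * b ^ β :=
        mul_le_mul (Real.rpow_le_rpow hx ha (by linarith)) (Real.rpow_le_rpow hx hb hβ0)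
          (by positivity) (Real.rpow_nonneg (hx.trans ha) _)

theorem mul_pow_rpow {c u α : ℝ} (hc : 0 ≤ c) (hu : 0 ≤ u) (n : ℕ) :
    (c * u ^ n) ^ α = c ^ α * (u ^ α) ^ n := by
  rw [Real.mul_rpow hc (by positivity), Real.rpow_pow_comm hu]

/-- Let `F` preserve the hyperplane `p = 0` and contract `p`, and let `e` vanish on that
hyperplane. Then the cohomological equation `φ ∘ F = μ φ - e` has the `C^{1,β}` solution
`φ = ∑ μ ^ (-(n + 1)) e ∘ F^n` on the slab `|p| < 1`. The derivative of the `n`-th term is bounded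
by `(θ M / |μ|) ^ n` and is Lipschitz with constant `(M ^ 2 / |μ|) ^ n` up to factors, so that
interpolation between the two bounds yields Hölder continuity. -/
theorem exists_solution_cohomological {e : E → ℝ} {e' : E → E →L[ℝ] ℝ} {p : E →L[ℝ] ℝ}
    {θ μ β : ℝ} (hM : 1 < M) (hθ : 0 < θ) (hθ1 : θ < 1) (hK : 0 ≤ K) (hβ0 : 0 < β) (hβ1 : β ≤ 1)
    (hμ : 0 < |μ|) (hrate : θ * M / |μ| < 1)
    (hrateβ : (θ * M / |μ|) ^ (1 - β) * (M ^ 2 / |μ|) ^ β < 1)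
    (hF : ∀ z, HasFDerivAt F (F' z) z) (hFM : ∀ z, ‖F' z‖ ≤ M)
    (hFK : ∀ z w, ‖F' z - F' w‖ ≤ K * ‖z - w‖) (hpF : ∀ z, |p (F z)| ≤ θ * |p z|)
    (hpF' : ∀ z v, |p (F' z v)| ≤ θ * |p v| + K * |p z| * ‖v‖)
    (he : ∀ z, HasFDerivAt e (e' z) z) (heK : ∀ z w, ‖e' z - e' w‖ ≤ K * ‖z - w‖)
    (he' : ∀ z v, |e' z v| ≤ K * (|p v| + |p z| * ‖v‖))
    (hF0 : F 0 = 0) (he0 : e 0 = 0) (he'0 : e' 0 = 0) :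
    ∃ φ : E → ℝ, IsC1HolderOn β φ {z | |p z| < 1} ∧ φ 0 = 0 ∧ fderiv ℝ φ 0 = 0 ∧
      ∀ z, |p z| < 1 → φ (F z) = μ * φ z - e z := by
  have hM0 : 0 < M := one_pos.trans hM
  have hM1 : 0 < M - 1 := sub_pos.2 hM
  have hMM : 0 < M ^ 2 - M := by nlinarith
  have hμ0 : μ ≠ 0 := abs_pos.1 hμ
  set s : Set E := {z | |p z| < 1} with hs
  have hso : IsOpen s := isOpen_lt (by fun_prop) continuous_const
  have hsc : Convex ℝ s := by
    have h1 : s = p ⁻¹' ball (0 : ℝ) 1 := by ext z; simp [hs]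
    rw [h1]
    exact (convex_ball (0 : ℝ) 1).linear_preimage p.toLinearMap
  have h0s : (0 : E) ∈ s := by simp [hs]
  set C₁ := ‖p‖ + K / (θ * (M - 1)) with hC₁
  set C₂ := K / (M ^ 2 - M) with hC₂
  have hC₁0 : 0 ≤ C₁ := by positivity
  have hC₂0 : 0 ≤ C₂ := by positivity
  let A := iterateFDeriv F F'
  let t : ℕ → E → ℝ := fun n z => (μ ^ (n + 1))⁻¹ * e (F^[n] z)
  let t' : ℕ → E → E →L[ℝ] ℝ := fun n z => (μ ^ (n + 1))⁻¹ • (e' (F^[n] z)).comp (A n z)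
  have ht : ∀ n z, HasFDerivAt (t n) (t' n z) z := fun n z =>
    ((he _).comp z (hasFDerivAt_iterate hF n z)).const_mul _
  have hμn : ∀ n : ℕ, ‖(μ ^ (n + 1))⁻¹‖ = |μ|⁻¹ * (|μ| ^ n)⁻¹ := by
    intro n
    rw [norm_inv, norm_pow, Real.norm_eq_abs, pow_succ', mul_inv]
  have hpn : ∀ n, ∀ z ∈ s, |p (F^[n] z)| ≤ θ ^ n := fun n z hz =>
    (abs_apply_iterateFDeriv_le hM hθ hK hFM hpF hpF' hz n 0).1
  set Ca := |μ|⁻¹ * (K * (C₁ + 1)) with hCa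
  have hCa0 : 0 ≤ Ca := by positivity
  have htb : ∀ n, ∀ z ∈ s, ‖t' n z‖ ≤ Ca * (θ * M / |μ|) ^ n := by
    intro n z hz
    have h1 : ‖(e' (F^[n] z)).comp (A n z)‖ ≤ K * (C₁ + 1) * (θ * M) ^ n := by
      refine ContinuousLinearMap.opNorm_le_bound _ (by positivity) fun v => ?_
      have h2 := (abs_apply_iterateFDeriv_le hM hθ hK hFM hpF hpF' hz n v).2
      have h3 : ‖A n z v‖ ≤ M ^ n * ‖v‖ :=
        (ContinuousLinearMap.le_opNorm _ _).trans
          (mul_le_mul_of_nonneg_right (norm_iterateFDeriv_le hM0.le hFM n z) (norm_nonneg _))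
      calc |e' (F^[n] z) (A n z v)|
          ≤ K * (|p (A n z v)| + |p (F^[n] z)| * ‖A n z v‖) := he' _ _
        _ ≤ K * (C₁ * (θ * M) ^ n * ‖v‖ + θ ^ n * (M ^ n * ‖v‖)) := by
            gcongr
            exact hpn n z hz
        _ = _ := by rw [mul_pow]; ring
    rw [norm_smul, hμn]
    calc _ ≤ |μ|⁻¹ * (|μ| ^ n)⁻¹ * (K * (C₁ + 1) * (θ * M) ^ n) := by gcongr
      _ = _ := by rw [div_pow]; ring
  have hsum : Summable fun n => Ca * (θ * M / |μ|) ^ n :=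
    (summable_geometric_of_lt_one (by positivity) hrate).mul_left _
  have hFn0 : ∀ n, F^[n] 0 = 0 := fun n => Function.iterate_fixed hF0 n
  have ht0 : ∀ n, t n 0 = 0 := fun n => by simp [t, hFn0, he0]
  have ht'0 : ∀ n, t' n 0 = 0 := fun n => by simp [t', hFn0, he'0]
  have hts0 : Summable fun n => t n 0 := by simp [ht0]
  have hts : ∀ z ∈ s, Summable fun n => t n z := fun z hz =>
    summable_of_summable_hasFDerivAt_of_isPreconnected hsum hso hsc.isPreconnected
      (fun n z _ => ht n z) htb h0s hts0 hz
  have hφ : ∀ z ∈ s, HasFDerivAt (fun z => ∑' n, t n z) (∑' n, t' n z) z := fun z hz =>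
    hasFDerivAt_tsum_of_isPreconnected hsum hso hsc.isPreconnected
      (fun n z _ => ht n z) htb h0s hts0 hz
  have ht's : ∀ z ∈ s, Summable fun n => t' n z := fun z hz =>
    Summable.of_norm_bounded hsum fun n => htb n z hz
  set Cb := |μ|⁻¹ * (K + K * (‖p‖ + 1) * C₂) with hCb
  have hCb0 : 0 ≤ Cb := by positivity
  have hep : ∀ z ∈ s, ‖e' z‖ ≤ K * (‖p‖ + 1) := by
    intro z hz
    refine ContinuousLinearMap.opNorm_le_bound _ (by positivity) fun v => ?_
    have h1 := p.le_opNorm v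
    rw [Real.norm_eq_abs] at h1
    have hz' : |p z| ≤ 1 := (show |p z| < 1 from hz).le
    calc |e' z v| ≤ K * (|p v| + |p z| * ‖v‖) := he' z v
      _ ≤ K * (‖p‖ * ‖v‖ + 1 * ‖v‖) := by gcongr
      _ = _ := by ring
  have hFs : ∀ n, ∀ z ∈ s, F^[n] z ∈ s := by
    intro n z hz
    induction n with
    | zero => exact hz
    | succ n ih =>
      rw [Function.iterate_succ_apply']
      have h1 : |p (F^[n] z)| < 1 := ih
      have h2 := hpF (F^[n] z)
      change |p (F (F^[n] z))| < 1
      nlinarith [abs_nonneg (p (F^[n] z))]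
  have htl : ∀ n, ∀ z ∈ s, ∀ w ∈ s, ‖t' n z - t' n w‖ ≤ Cb * (M ^ 2 / |μ|) ^ n * ‖z - w‖ := by
    intro n z hz w hw
    have key : (e' (F^[n] z)).comp (A n z) - (e' (F^[n] w)).comp (A n w)
        = (e' (F^[n] z) - e' (F^[n] w)).comp (A n z) + (e' (F^[n] w)).comp (A n z - A n w) := by
      ext v; simp
    have h1 : ‖e' (F^[n] z) - e' (F^[n] w)‖ ≤ K * (M ^ n * ‖z - w‖) :=
      (heK _ _).trans (mul_le_mul_of_nonneg_left (norm_iterate_sub_le hM0.le hF hFM n z w) hK)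
    have h2 : ‖(e' (F^[n] z)).comp (A n z) - (e' (F^[n] w)).comp (A n w)‖
        ≤ (K + K * (‖p‖ + 1) * C₂) * (M ^ 2) ^ n * ‖z - w‖ := by
      rw [key]
      calc _ ≤ _ := norm_add_le _ _
        _ ≤ _ := add_le_add (ContinuousLinearMap.opNorm_comp_le _ _)
            (ContinuousLinearMap.opNorm_comp_le _ _)
        _ ≤ K * (M ^ n * ‖z - w‖) * M ^ n
            + K * (‖p‖ + 1) * (C₂ * (M ^ 2) ^ n * ‖z - w‖) :=
          add_le_add (mul_le_mul h1 (norm_iterateFDeriv_le hM0.le hFM n z) (norm_nonneg _)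
            (by positivity)) (mul_le_mul (hep _ (hFs n w hw))
            (norm_iterateFDeriv_sub_le hM hK hF hFM hFK n z w) (norm_nonneg _) (by positivity))
        _ = _ := by rw [← pow_mul, mul_comm 2 n, pow_mul]; ring
    have h3 : t' n z - t' n w
        = (μ ^ (n + 1))⁻¹ • ((e' (F^[n] z)).comp (A n z) - (e' (F^[n] w)).comp (A n w)) :=
      (smul_sub _ _ _).symm
    rw [h3, norm_smul, hμn]
    calc _ ≤ |μ|⁻¹ * (|μ| ^ n)⁻¹ * ((K + K * (‖p‖ + 1) * C₂) * (M ^ 2) ^ n * ‖z - w‖) := by gcongr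
      _ = _ := by rw [div_pow]; ring
  set q := (θ * M / |μ|) ^ (1 - β) * (M ^ 2 / |μ|) ^ β with hq
  have hq0 : 0 ≤ q := by positivity
  set Cc := (2 * Ca) ^ (1 - β) * Cb ^ β with hCc
  have hth : ∀ z ∈ s, ∀ w ∈ s, ∀ n, ‖t' n z - t' n w‖ ≤ Cc * ‖z - w‖ ^ β * q ^ n := by
    intro z hz w hw n
    have h1 : ‖t' n z - t' n w‖ ≤ 2 * Ca * (θ * M / |μ|) ^ n := by
      have := norm_sub_le (t' n z) (t' n w)
      linarith [htb n z hz, htb n w hw]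
    refine (le_rpow_mul_rpow (norm_nonneg _) h1 (htl n z hz w hw) hβ0.le hβ1).trans_eq ?_
    have ha : 0 ≤ θ * M / |μ| := by positivity
    have hb : 0 ≤ M ^ 2 / |μ| := by positivity
    rw [mul_pow_rpow (by positivity) ha, Real.mul_rpow (by positivity) (norm_nonneg _),
      mul_pow_rpow hCb0 hb, hq, mul_pow]
    ring
  refine ⟨fun z => ∑' n, t n z, isC1HolderOn_of_hasFDerivAt (C := Cc * ∑' n, q ^ n) hβ0 hso hφ ?_,
    by simp [ht0], ?_, ?_⟩
  · intro z hz w hw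
    rw [← (ht's z hz).tsum_sub (ht's w hw)]
    have hg := (summable_geometric_of_lt_one hq0 hrateβ).hasSum.mul_left (Cc * ‖z - w‖ ^ β)
    refine (tsum_of_norm_bounded hg (hth z hz w hw)).trans_eq (by ring)
  · rw [(hφ 0 h0s).fderiv]
    simp [ht'0]
  · intro z hz
    have h1 : ∀ n, t n (F z) = μ * t (n + 1) z := by
      intro n
      simp only [t, Function.iterate_succ_apply, pow_succ]
      field_simp
    have h2 := (hts z hz).tsum_eq_zero_add
    simp only [h1]
    rw [tsum_mul_left, h2]
    simp only [t, Function.iterate_zero, id, zero_add, pow_one]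
    field_simp
    ring

end Series

/-! ### The linearized unstable curve -/

section Curve

variable {E : Type*} [NormedAddCommGroup E] [NormedSpace ℝ E]

/-- Successive approximations `γ_{n+1}(t) = F (γ_n (ν t))` to the unstable curve, starting from the
straight line in direction `u`. -/
def curveApprox (F : E → E) (u : E) (ν : ℝ) : ℕ → ℝ → E
  | 0, t => t • u
  | n + 1, t => F (curveApprox F u ν n (ν * t))

/-- The derivatives of the curves `curveApprox F u ν n`. -/
def curveApproxFDeriv (F : E → E) (F' : E → E →L[ℝ] E) (u : E) (ν : ℝ) : ℕ → ℝ → ℝ →L[ℝ] E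
  | 0, _ => ContinuousLinearMap.toSpanSingleton ℝ u
  | n + 1, t => ν • (F' (curveApprox F u ν n (ν * t))).comp (curveApproxFDeriv F F' u ν n (ν * t))

variable {F : E → E} {F' : E → E →L[ℝ] E} {u : E} {ν : ℝ}

theorem hasFDerivAt_curveApprox (hF : ∀ z, HasFDerivAt F (F' z) z) (n : ℕ) (t : ℝ) :
    HasFDerivAt (curveApprox F u ν n) (curveApproxFDeriv F F' u ν n t) t := by
  induction n generalizing t with
  | zero => exact (ContinuousLinearMap.toSpanSingleton ℝ u).hasFDerivAt
  | succ n ih =>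
    have h1 : HasFDerivAt (fun t : ℝ => ν * t) (ν • ContinuousLinearMap.id ℝ ℝ) t :=
      (hasFDerivAt_id t).const_mul ν
    refine ((hF _).comp t ((ih (ν * t)).comp t h1)).congr_fderiv ?_
    ext
    simp [curveApproxFDeriv]

theorem curveApprox_zero_right (hF0 : F 0 = 0) (n : ℕ) : curveApprox F u ν n 0 = 0 := by
  induction n with
  | zero => simp [curveApprox]
  | succ n ih => simp [curveApprox, ih, hF0]

theorem curveApproxFDeriv_zero_right (hF0 : F 0 = 0) (hu : ν • F' 0 u = u) (n : ℕ) :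
    curveApproxFDeriv F F' u ν n 0 = ContinuousLinearMap.toSpanSingleton ℝ u := by
  induction n with
  | zero => rfl
  | succ n ih =>
    ext
    simp [curveApproxFDeriv, ih, curveApprox_zero_right hF0, hu]

theorem mul_mem_ball_zero {ν t r : ℝ} (hν : |ν| ≤ 1) (ht : t ∈ ball (0 : ℝ) r) :
    ν * t ∈ ball (0 : ℝ) r := by
  rw [mem_ball_zero_iff, Real.norm_eq_abs] at ht ⊢
  rw [abs_mul]
  exact (mul_le_of_le_one_left (abs_nonneg t) hν).trans_lt ht

/-- The derivatives of the approximating curves are Lipschitz with the same constant on a fixed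
interval: the recursion multiplies the Lipschitz constant by `M / μ ^ 2 < 1`. -/
theorem norm_curveApproxFDeriv_sub_le {M K L r : ℝ} (hM : 0 ≤ M) (hK : 0 ≤ K) (hL : 0 ≤ L)
    (hν : |ν| < 1) (hr : 0 < r) (hLr : L * r ≤ 1)
    (hL' : ν ^ 2 * (K * (‖u‖ + 1) ^ 2 + M * L) ≤ L)
    (hF : ∀ z, HasFDerivAt F (F' z) z) (hFM : ∀ z, ‖F' z‖ ≤ M)
    (hFK : ∀ z w, ‖F' z - F' w‖ ≤ K * ‖z - w‖) (hF0 : F 0 = 0) (hu : ν • F' 0 u = u) (n : ℕ) :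
    (∀ t ∈ ball (0 : ℝ) r, ∀ s ∈ ball (0 : ℝ) r,
      ‖curveApproxFDeriv F F' u ν n t - curveApproxFDeriv F F' u ν n s‖ ≤ L * ‖t - s‖) ∧
    (∀ t ∈ ball (0 : ℝ) r, ‖curveApproxFDeriv F F' u ν n t‖ ≤ ‖u‖ + 1) ∧
    ∀ t ∈ ball (0 : ℝ) r, ∀ s ∈ ball (0 : ℝ) r,
      ‖curveApprox F u ν n t - curveApprox F u ν n s‖ ≤ (‖u‖ + 1) * ‖t - s‖ := by
  have aux : ∀ n, (∀ t ∈ ball (0 : ℝ) r, ∀ s ∈ ball (0 : ℝ) r,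
      ‖curveApproxFDeriv F F' u ν n t - curveApproxFDeriv F F' u ν n s‖ ≤ L * ‖t - s‖) →
      (∀ t ∈ ball (0 : ℝ) r, ‖curveApproxFDeriv F F' u ν n t‖ ≤ ‖u‖ + 1) ∧
      ∀ t ∈ ball (0 : ℝ) r, ∀ s ∈ ball (0 : ℝ) r,
        ‖curveApprox F u ν n t - curveApprox F u ν n s‖ ≤ (‖u‖ + 1) * ‖t - s‖ := by
    intro n h
    have hb : ∀ t ∈ ball (0 : ℝ) r, ‖curveApproxFDeriv F F' u ν n t‖ ≤ ‖u‖ + 1 := by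
      intro t ht
      have h1 := h t ht 0 (mem_ball_self hr)
      rw [curveApproxFDeriv_zero_right hF0 hu, sub_zero] at h1
      have h2 := norm_sub_norm_le (curveApproxFDeriv F F' u ν n t)
        (ContinuousLinearMap.toSpanSingleton ℝ u)
      rw [ContinuousLinearMap.norm_toSpanSingleton] at h2
      have h3 := (mem_ball_zero_iff.1 ht).le
      nlinarith
    exact ⟨hb, fun t ht s hs => Convex.norm_image_sub_le_of_norm_hasFDerivWithin_le
      (fun v _ => (hasFDerivAt_curveApprox hF n v).hasFDerivWithinAt) hb (convex_ball _ _) hs ht⟩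
  suffices h : ∀ t ∈ ball (0 : ℝ) r, ∀ s ∈ ball (0 : ℝ) r,
      ‖curveApproxFDeriv F F' u ν n t - curveApproxFDeriv F F' u ν n s‖ ≤ L * ‖t - s‖ from
    ⟨h, aux n h⟩
  induction n with
  | zero => intro t _ s _; simp only [curveApproxFDeriv, sub_self, norm_zero]; positivity
  | succ n ih =>
    obtain ⟨hb, hl⟩ := aux n ih
    intro t ht s hs
    have ht' := mul_mem_ball_zero hν.le ht
    have hs' := mul_mem_ball_zero hν.le hs
    have key : curveApproxFDeriv F F' u ν (n + 1) t - curveApproxFDeriv F F' u ν (n + 1) s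
        = ν • ((F' (curveApprox F u ν n (ν * t)) - F' (curveApprox F u ν n (ν * s))).comp
            (curveApproxFDeriv F F' u ν n (ν * t))
          + (F' (curveApprox F u ν n (ν * s))).comp
            (curveApproxFDeriv F F' u ν n (ν * t) - curveApproxFDeriv F F' u ν n (ν * s))) := by
      ext; simp [curveApproxFDeriv, smul_sub]
    have hd : ‖ν * t - ν * s‖ = |ν| * ‖t - s‖ := by
      rw [← mul_sub, norm_mul, Real.norm_eq_abs]
    have h1 := (hFK _ _).trans (mul_le_mul_of_nonneg_left (hl _ ht' _ hs') hK)
    have h2 := ih _ ht' _ hs'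
    rw [hd] at h1 h2
    rw [key, norm_smul, Real.norm_eq_abs]
    calc _ ≤ |ν| * (K * ((‖u‖ + 1) * (|ν| * ‖t - s‖)) * (‖u‖ + 1)
          + M * (L * (|ν| * ‖t - s‖))) := by
          refine mul_le_mul_of_nonneg_left ((norm_add_le _ _).trans (add_le_add
            (ContinuousLinearMap.opNorm_comp_le _ _) (ContinuousLinearMap.opNorm_comp_le _ _) |>.trans
            (add_le_add (mul_le_mul h1 (hb _ ht') (norm_nonneg _) (by positivity))
              (mul_le_mul (hFM _) h2 (norm_nonneg _) hM)))) (abs_nonneg ν)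
      _ = ν ^ 2 * (K * (‖u‖ + 1) ^ 2 + M * L) * ‖t - s‖ := by rw [← sq_abs ν]; ring
      _ ≤ L * ‖t - s‖ := mul_le_mul_of_nonneg_right hL' (norm_nonneg _)

/-- Consecutive approximations to the unstable curve, and their derivatives, approach each other
geometrically on a fixed interval. -/
theorem norm_curveApprox_succ_sub_le {M M' K L r D : ℝ} (hM : 0 ≤ M) (hMM' : M ≤ M') (hK : 0 ≤ K)
    (hL : 0 ≤ L) (hν : |ν| < 1) (hr : 0 < r) (hr1 : r ≤ 1) (hLr : L * r ≤ 1)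
    (hL' : ν ^ 2 * (K * (‖u‖ + 1) ^ 2 + M * L) ≤ L)
    (hD : 2 * L ≤ D) (hD' : K * (2 * L) * (‖u‖ + 1) + M * D ≤ M' * D)
    (hF : ∀ z, HasFDerivAt F (F' z) z) (hFM : ∀ z, ‖F' z‖ ≤ M)
    (hFK : ∀ z w, ‖F' z - F' w‖ ≤ K * ‖z - w‖) (hF0 : F 0 = 0) (hu : ν • F' 0 u = u) (n : ℕ)
    {t : ℝ} (ht : t ∈ ball (0 : ℝ) r) :
    ‖curveApprox F u ν (n + 1) t - curveApprox F u ν n t‖ ≤ 2 * L * (ν ^ 2 * M') ^ n * |t| ^ 2 ∧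
      ‖curveApproxFDeriv F F' u ν (n + 1) t - curveApproxFDeriv F F' u ν n t‖
        ≤ D * (ν ^ 2 * M') ^ n * |t| := by
  have hM' : 0 ≤ M' := hM.trans hMM'
  have hlip := norm_curveApproxFDeriv_sub_le hM hK hL hν hr hLr hL' hF hFM hFK hF0 hu
  induction n generalizing t with
  | zero =>
    have h1 : ∀ s ∈ ball (0 : ℝ) r, ‖curveApproxFDeriv F F' u ν 1 s
        - curveApproxFDeriv F F' u ν 0 s‖ ≤ 2 * L * |s| := by
      intro s hs
      have ha := (hlip 1).1 s hs 0 (mem_ball_self hr)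
      have hb := (hlip 0).1 s hs 0 (mem_ball_self hr)
      rw [curveApproxFDeriv_zero_right hF0 hu, sub_zero, Real.norm_eq_abs] at ha hb
      have := norm_sub_le_norm_sub_add_norm_sub (curveApproxFDeriv F F' u ν 1 s)
        (ContinuousLinearMap.toSpanSingleton ℝ u) (curveApproxFDeriv F F' u ν 0 s)
      rw [norm_sub_rev (ContinuousLinearMap.toSpanSingleton ℝ u)] at this
      linarith
    have ht' : |t| < r := by simpa using ht
    refine ⟨?_, ?_⟩
    · have h2 := Convex.norm_image_sub_le_of_norm_hasFDerivWithin_le (s := closedBall (0 : ℝ) |t|)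
        (f := fun s => curveApprox F u ν 1 s - curveApprox F u ν 0 s) (C := 2 * L * |t|)
        (x := 0) (y := t)
        (fun v _ => ((hasFDerivAt_curveApprox hF 1 v).sub
          (hasFDerivAt_curveApprox hF 0 v)).hasFDerivWithinAt)
        (fun v hv => ?_) (convex_closedBall _ _) (mem_closedBall_self (abs_nonneg t)) (by simp)
      · simp only [curveApprox_zero_right hF0, sub_zero, Real.norm_eq_abs] at h2
        simp only [zero_add, pow_zero, mul_one]
        linarith
      · have hv' : |v| ≤ |t| := by simpa using hv
        refine (h1 v (by simpa using hv'.trans_lt ht')).trans ?_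
        exact mul_le_mul_of_nonneg_left hv' (by positivity)
    · simp only [zero_add, pow_zero, mul_one]
      exact (h1 t ht).trans (mul_le_mul_of_nonneg_right hD (abs_nonneg t))
  | succ n ih =>
    have ht' := mul_mem_ball_zero hν.le ht
    obtain ⟨ih1, ih2⟩ := ih ht'
    have hκ : 0 ≤ ν ^ 2 * M' := by positivity
    have hFl : ∀ z w, ‖F z - F w‖ ≤ M * ‖z - w‖ := fun z w => by
      simpa using norm_iterate_sub_le hM hF hFM 1 z w
    rw [abs_mul] at ih1 ih2
    constructor
    · calc _ ≤ M * (2 * L * (ν ^ 2 * M') ^ n * (|ν| * |t|) ^ 2) :=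
            (hFl _ _).trans (mul_le_mul_of_nonneg_left ih1 hM)
        _ ≤ M' * (2 * L * (ν ^ 2 * M') ^ n * (|ν| * |t|) ^ 2) := by gcongr
        _ = _ := by rw [mul_pow |ν|, sq_abs ν, pow_succ]; ring
    · have hν1 : |ν| ^ 3 * |t| ^ 2 ≤ ν ^ 2 * |t| := by
        have htr : |t| ≤ 1 := by
          have : |t| < r := by simpa using ht
          linarith
        rw [← sq_abs ν]
        have h1 : |ν| * |t| ≤ 1 := mul_le_one₀ hν.le (abs_nonneg _) htr
        calc |ν| ^ 3 * |t| ^ 2 = |ν| ^ 2 * |t| * (|ν| * |t|) := by ring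
          _ ≤ |ν| ^ 2 * |t| * 1 := by gcongr
          _ = _ := mul_one _
      have key : curveApproxFDeriv F F' u ν (n + 1 + 1) t - curveApproxFDeriv F F' u ν (n + 1) t
          = ν • ((F' (curveApprox F u ν (n + 1) (ν * t)) - F' (curveApprox F u ν n (ν * t))).comp
              (curveApproxFDeriv F F' u ν (n + 1) (ν * t))
            + (F' (curveApprox F u ν n (ν * t))).comp (curveApproxFDeriv F F' u ν (n + 1) (ν * t)
              - curveApproxFDeriv F F' u ν n (ν * t))) := by
        ext; simp [curveApproxFDeriv, smul_sub]
      rw [key, norm_smul, Real.norm_eq_abs]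
      calc _ ≤ |ν| * (K * (2 * L * (ν ^ 2 * M') ^ n * (|ν| * |t|) ^ 2) * (‖u‖ + 1)
            + M * (D * (ν ^ 2 * M') ^ n * (|ν| * |t|))) := by
            refine mul_le_mul_of_nonneg_left ((norm_add_le _ _).trans (add_le_add
              (ContinuousLinearMap.opNorm_comp_le _ _)
              (ContinuousLinearMap.opNorm_comp_le _ _) |>.trans
              (add_le_add (mul_le_mul ((hFK _ _).trans (mul_le_mul_of_nonneg_left ih1 hK))
                ((hlip (n + 1)).2.1 _ ht') (norm_nonneg _) (by positivity))
                (mul_le_mul (hFM _) ih2 (norm_nonneg _) hM)))) (abs_nonneg ν)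
        _ = (ν ^ 2 * M') ^ n * (K * (2 * L) * (‖u‖ + 1) * (|ν| ^ 3 * |t| ^ 2)
              + M * D * (|ν| ^ 2 * |t|)) := by ring
        _ ≤ (ν ^ 2 * M') ^ n * (K * (2 * L) * (‖u‖ + 1) * (ν ^ 2 * |t|)
              + M * D * (ν ^ 2 * |t|)) := by
            rw [sq_abs ν]
            exact mul_le_mul_of_nonneg_left
              (add_le_add (mul_le_mul_of_nonneg_left hν1 (by positivity)) le_rfl) (by positivity)
        _ = (ν ^ 2 * M') ^ n * (ν ^ 2 * |t|) * (K * (2 * L) * (‖u‖ + 1) + M * D) := by ring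
        _ ≤ (ν ^ 2 * M') ^ n * (ν ^ 2 * |t|) * (M' * D) := by gcongr
        _ = _ := by rw [pow_succ]; ring

/-- If `u` is an eigenvector of `F' 0` with eigenvalue `μ`, `|μ| > 1`, and `‖F'‖ ≤ M < μ ^ 2`, then
there is an invariant `C^{1,1}` curve tangent to `u` on which `F` acts as multiplication by `μ`. -/
theorem exists_linearized_curve [CompleteSpace E] {M K μ : ℝ} (hK : 0 ≤ K) (hμ : 1 < |μ|)
    (hMμ : M < μ ^ 2) (hF : ∀ z, HasFDerivAt F (F' z) z) (hFM : ∀ z, ‖F' z‖ ≤ M)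
    (hFK : ∀ z w, ‖F' z - F' w‖ ≤ K * ‖z - w‖) (hF0 : F 0 = 0) (hu : F' 0 u = μ • u) :
    ∃ γ : ℝ → E, C1HolderAt 1 γ 0 ∧ γ 0 = 0 ∧
      HasFDerivAt γ (ContinuousLinearMap.toSpanSingleton ℝ u) 0 ∧
      ∀ᶠ t in 𝓝 0, F (γ t) = γ (μ * t) := by
  have hμ0 : μ ≠ 0 := abs_pos.1 (one_pos.trans hμ)
  have hM : 0 ≤ M := (norm_nonneg _).trans (hFM 0)
  have hμ2 : 0 < μ ^ 2 := by positivity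
  have hν : |μ⁻¹| < 1 := by rw [abs_inv]; exact inv_lt_one_of_one_lt₀ hμ
  have hν2 : (μ⁻¹) ^ 2 = (μ ^ 2)⁻¹ := inv_pow μ 2
  have hu' : μ⁻¹ • F' 0 u = u := by rw [hu, smul_smul, inv_mul_cancel₀ hμ0, one_smul]
  have hgap : 0 < μ ^ 2 - M := sub_pos.2 hMμ
  obtain ⟨M', hMM', hM'μ⟩ := exists_between hMμ
  have hgap' : 0 < M' - M := sub_pos.2 hMM'
  set L := K * (‖u‖ + 1) ^ 2 / (μ ^ 2 - M) with hLdef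
  have hL : 0 ≤ L := by positivity
  set r := 1 / (L + 1) with hrdef
  have hr : 0 < r := by positivity
  have hr1 : r ≤ 1 := by rw [hrdef, div_le_one (by positivity)]; linarith
  have hLr : L * r ≤ 1 := by
    rw [hrdef, mul_one_div, div_le_one (by positivity)]; linarith
  have hL' : (μ⁻¹) ^ 2 * (K * (‖u‖ + 1) ^ 2 + M * L) ≤ L := by
    have h1 : K * (‖u‖ + 1) ^ 2 = L * (μ ^ 2 - M) := by rw [hLdef]; field_simp
    rw [h1, hν2, inv_mul_le_iff₀ hμ2]
    linarith
  set D := 2 * L + K * (2 * L) * (‖u‖ + 1) / (M' - M) with hDdef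
  have hD : 2 * L ≤ D := le_add_of_nonneg_right (by positivity)
  have hD0 : 0 ≤ D := by positivity
  have hD' : K * (2 * L) * (‖u‖ + 1) + M * D ≤ M' * D := by
    have h1 : K * (2 * L) * (‖u‖ + 1) / (M' - M) ≤ D := le_add_of_nonneg_left (by positivity)
    rw [div_le_iff₀ hgap'] at h1
    linarith
  set κ := (μ⁻¹) ^ 2 * M' with hκdef
  have hκ0 : 0 ≤ κ := by have := hM.trans hMM'.le; positivity
  have hκ1 : κ < 1 := by
    rw [hκdef, hν2, inv_mul_lt_iff₀ hμ2, mul_one]; exact hM'μ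
  set c := curveApprox F u μ⁻¹ with hc
  set c' := curveApproxFDeriv F F' u μ⁻¹ with hc'
  have hcd : ∀ n t, HasFDerivAt (c n) (c' n t) t := fun n t => hasFDerivAt_curveApprox hF n t
  have hlip := norm_curveApproxFDeriv_sub_le hM hK hL hν hr hLr hL' hF hFM hFK hF0 hu'
  have hgeo := fun n {t} (ht : t ∈ ball (0 : ℝ) r) => norm_curveApprox_succ_sub_le hM hMM'.le hK hL
    hν hr hr1 hLr hL' hD hD' hF hFM hFK hF0 hu' n ht
  have hbound : ∀ n, ∀ t ∈ ball (0 : ℝ) r, ‖c' (n + 1) t - c' n t‖ ≤ D * κ ^ n := by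
    intro n t ht
    have h1 : |t| ≤ 1 := by
      have : |t| < r := by simpa using ht
      linarith
    exact (hgeo n ht).2.trans (mul_le_of_le_one_right (by positivity) h1)
  have hsum : Summable fun n => D * κ ^ n := (summable_geometric_of_lt_one hκ0 hκ1).mul_left D
  have h0 : (0 : ℝ) ∈ ball (0 : ℝ) r := mem_ball_self hr
  have hc0 : ∀ n, c n 0 = 0 := fun n => curveApprox_zero_right hF0 n
  have hs0 : Summable fun n => c (n + 1) 0 - c n 0 := by simp [hc0]
  have hdd : ∀ n, ∀ t ∈ ball (0 : ℝ) r,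
      HasFDerivAt (fun t => c (n + 1) t - c n t) (c' (n + 1) t - c' n t) t :=
    fun n t _ => (hcd (n + 1) t).sub (hcd n t)
  have hpre : IsPreconnected (ball (0 : ℝ) r) := (convex_ball _ _).isPreconnected
  set γ : ℝ → E := fun t => c 0 t + ∑' n, (c (n + 1) t - c n t) with hγ
  set γ' : ℝ → ℝ →L[ℝ] E := fun t => c' 0 t + ∑' n, (c' (n + 1) t - c' n t) with hγ'
  have hγd : ∀ t ∈ ball (0 : ℝ) r, HasFDerivAt γ (γ' t) t := fun t ht =>
    (hcd 0 t).add (hasFDerivAt_tsum_of_isPreconnected hsum isOpen_ball hpre hdd hbound h0 hs0 ht)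
  have hlim : ∀ t ∈ ball (0 : ℝ) r, Tendsto (fun n => c n t) atTop (𝓝 (γ t)) := by
    intro t ht
    have h1 := (summable_of_summable_hasFDerivAt_of_isPreconnected hsum isOpen_ball hpre hdd hbound
      h0 hs0 ht).hasSum.tendsto_sum_nat.const_add (c 0 t)
    refine h1.congr fun n => ?_
    rw [Finset.sum_range_sub (fun n => c n t)]
    abel
  have hlim' : ∀ t ∈ ball (0 : ℝ) r, Tendsto (fun n => c' n t) atTop (𝓝 (γ' t)) := by
    intro t ht
    have h1 := (Summable.of_norm_bounded hsum
      fun n => hbound n t ht).hasSum.tendsto_sum_nat.const_add (c' 0 t)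
    refine h1.congr fun n => ?_
    rw [Finset.sum_range_sub (fun n => c' n t)]
    abel
  refine ⟨γ, ⟨r, hr, isC1HolderOn_of_hasFDerivAt (C := L) one_pos isOpen_ball hγd ?_⟩, ?_, ?_, ?_⟩
  · intro t ht s hs
    rw [Real.rpow_one]
    exact le_of_tendsto ((hlim' t ht).sub (hlim' s hs)).norm
      (Eventually.of_forall fun n => (hlip n).1 t ht s hs)
  · exact tendsto_nhds_unique (hlim 0 h0) (by simp [hc0])
  · have h1 : γ' 0 = ContinuousLinearMap.toSpanSingleton ℝ u := by
      refine tendsto_nhds_unique (hlim' 0 h0) ?_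
      simp only [hc', curveApproxFDeriv_zero_right hF0 hu']
      exact tendsto_const_nhds
    exact h1 ▸ hγd 0 h0
  · have hev : ∀ᶠ t in 𝓝 (0 : ℝ), t ∈ ball (0 : ℝ) r ∧ μ * t ∈ ball (0 : ℝ) r := by
      refine Eventually.and (ball_mem_nhds _ hr) ?_
      have h1 : ContinuousAt (fun t : ℝ => μ * t) 0 := by fun_prop
      apply h1.eventually
      simp only [mul_zero]
      exact ball_mem_nhds _ hr
    filter_upwards [hev] with t ht
    have h1 := ((hlim _ ht.2).comp (tendsto_add_atTop_nat 1))
    refine tendsto_nhds_unique ?_ h1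
    have h2 : ∀ n, c (n + 1) (μ * t) = F (c n t) := by
      intro n
      simp only [hc, curveApprox, ← mul_assoc, inv_mul_cancel₀ hμ0, one_mul]
    simp only [Function.comp_def, h2]
    exact (hF _).continuousAt.tendsto.comp (hlim t ht.1)

end Curve

/-! ### Linearizing one coordinate of a planar saddle -/

section Planar

/-- The linear map `(x, y) ↦ (a x, b y)` of the plane. -/
noncomputable def diagCLM (a b : ℝ) : ℝ × ℝ →L[ℝ] ℝ × ℝ :=
  (a • ContinuousLinearMap.id ℝ ℝ).prodMap (b • ContinuousLinearMap.id ℝ ℝ)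

@[simp] theorem diagCLM_apply (a b : ℝ) (z : ℝ × ℝ) : diagCLM a b z = (a * z.1, b * z.2) := rfl

theorem norm_diagCLM_le {a b : ℝ} (h : |a| ≤ |b|) : ‖diagCLM a b‖ ≤ |b| := by
  refine ContinuousLinearMap.opNorm_le_bound _ (abs_nonneg b) fun v => ?_
  rw [diagCLM_apply, Prod.norm_def, Prod.norm_def]
  simp only [norm_mul, Real.norm_eq_abs]
  refine max_le ?_ ?_
  · exact mul_le_mul h (le_max_left _ _) (abs_nonneg _) (abs_nonneg _)
  · exact mul_le_mul_of_nonneg_left (le_max_right _ _) (abs_nonneg _)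

/-- A map vanishing on the `y`-axis is controlled by the `x`-coordinate, and so is its derivative in
the `y`-direction. -/
theorem bounds_of_vanishing_on_axis {G : Type*} [NormedAddCommGroup G] [NormedSpace ℝ G]
    {g : ℝ × ℝ → G} {g' : ℝ × ℝ → ℝ × ℝ →L[ℝ] G} {η K : ℝ} (hK : 0 ≤ K)
    (hg : ∀ z, HasFDerivAt g (g' z) z) (hη : ∀ z, ‖g' z‖ ≤ η)
    (hgK : ∀ z w, ‖g' z - g' w‖ ≤ K * ‖z - w‖) (h0 : ∀ y, g (0, y) = 0) (z v : ℝ × ℝ) :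
    ‖g z‖ ≤ η * |z.1| ∧ ‖g' z v‖ ≤ η * |v.1| + K * |z.1| * ‖v‖ := by
  have hz : ‖z - (0, z.2)‖ = |z.1| := by
    rw [Prod.norm_def]; simp
  constructor
  · have := Convex.norm_image_sub_le_of_norm_hasFDerivWithin_le (s := Set.univ)
      (fun w _ => (hg w).hasFDerivWithinAt) (fun w _ => hη w) convex_univ
      (Set.mem_univ (0, z.2)) (Set.mem_univ z)
    rwa [h0, sub_zero, hz] at this
  · have h1 : g' (0, z.2) (0, v.2) = 0 := by
      have h2 : HasFDerivAt (fun y : ℝ => g (0, y))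
          ((g' (0, z.2)).comp (ContinuousLinearMap.inr ℝ ℝ ℝ)) z.2 :=
        (hg (0, z.2)).comp z.2 (ContinuousLinearMap.inr ℝ ℝ ℝ).hasFDerivAt
      simp only [h0] at h2
      have h3 := h2.unique (hasFDerivAt_const (0 : G) z.2)
      simpa using congrArg (fun L : ℝ →L[ℝ] G => L v.2) h3
    have h2 : g' z v = g' z (v.1, 0) + (g' z - g' (0, z.2)) (0, v.2) := by
      rw [sub_apply, h1, sub_zero, ← map_add]
      simp
    have h3 : ‖((v.1, 0) : ℝ × ℝ)‖ = |v.1| := by rw [Prod.norm_def]; simp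
    have h4 : ‖((0, v.2) : ℝ × ℝ)‖ ≤ ‖v‖ := by
      rw [Prod.norm_def, Prod.norm_def]; simp
    have h5 := hgK z (0, z.2)
    rw [hz] at h5
    rw [h2]
    refine (norm_add_le _ _).trans (add_le_add ?_ ?_)
    · rw [← h3]
      exact (ContinuousLinearMap.le_opNorm _ _).trans
        (mul_le_mul_of_nonneg_right (hη z) (norm_nonneg _))
    · exact (ContinuousLinearMap.le_opNorm _ _).trans
        (mul_le_mul h5 h4 (norm_nonneg _) (by positivity))

/-- The cut-off of a germ with diagonal linear part: a global map `diagCLM a b + g`. -/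
theorem exists_global_extension {a b η δ : ℝ} {F : ℝ × ℝ → ℝ × ℝ} (hF : C1HolderAt 1 F 0)
    (hA : HasFDerivAt F (diagCLM a b) 0) (hη : 0 < η) (hδ : 0 < δ) :
    ∃ (g : ℝ × ℝ → ℝ × ℝ) (g' : ℝ × ℝ → ℝ × ℝ →L[ℝ] ℝ × ℝ) (K : ℝ), 0 ≤ K ∧
      (∀ z, HasFDerivAt g (g' z) z) ∧ (∀ z, ‖g' z‖ ≤ η) ∧
      (∀ z w, ‖g' z - g' w‖ ≤ K * ‖z - w‖) ∧ (∀ᶠ z in 𝓝 0, diagCLM a b z + g z = F z) ∧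
      ∀ z, ∃ s : ℝ, ‖s • z‖ < δ ∧ g z = F (s • z) - diagCLM a b (s • z) := by
  have hf : C1HolderAt 1 (fun z => F z + (-diagCLM a b) z) 0 :=
    hF.add one_pos ((-diagCLM a b).c1HolderAt one_pos 0)
  have hf0 : fderiv ℝ (fun z => F z + (-diagCLM a b) z) 0 = 0 := by
    have := (hA.add (-diagCLM a b).hasFDerivAt).fderiv
    rwa [add_neg_cancel] at this
  obtain ⟨g, g', K, hK, hg, hgη, hgK, hgF, hgs⟩ := hf.exists_cutoff hf0 hη hδ
  refine ⟨g, g', K, hK, hg, hgη, hgK, ?_, fun z => ?_⟩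
  · filter_upwards [hgF] with z hz
    rw [hz, neg_apply]
    abel
  · obtain ⟨s, hs, h⟩ := hgs z
    refine ⟨s, hs, ?_⟩
    rw [h, neg_apply, sub_eq_add_neg]

/-- The linearizing coordinate in the case where the unstable manifold is the `y`-axis and the map
is linear on it. -/
theorem exists_linearizing_coordinate_of_straight {a b β : ℝ} {F : ℝ × ℝ → ℝ × ℝ}
    (hF : C1HolderAt 1 F 0) (hA : HasFDerivAt F (diagCLM a b) 0)
    (ha : 0 < |a|) (ha1 : |a| < 1) (hb : 1 < |b|) (hβ0 : 0 < β) (hβ1 : β ≤ 1)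
    (hrate : |a| ^ (1 - β) * |b| ^ β < 1) (haxis : ∀ᶠ y in 𝓝 (0 : ℝ), F (0, y) = (0, b * y)) :
    ∃ φ : ℝ × ℝ → ℝ, C1HolderAt β φ 0 ∧ φ 0 = 0 ∧
      HasFDerivAt φ (ContinuousLinearMap.snd ℝ ℝ ℝ) 0 ∧ ∀ᶠ z in 𝓝 0, φ (F z) = b * φ z := by
  have hb0 : 0 < |b| := one_pos.trans hb
  obtain ⟨δ, hδ, hδF⟩ := Metric.eventually_nhds_iff_ball.1 haxis
  obtain ⟨η, hη, hη1, hη2, hη3⟩ : ∃ η > 0, |a| + η < 1 ∧ (|a| + η) * (|b| + η) / |b| < 1 ∧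
      ((|a| + η) * (|b| + η) / |b|) ^ (1 - β) * ((|b| + η) ^ 2 / |b|) ^ β < 1 := by
    have h1 : ContinuousAt (fun η : ℝ => |a| + η) 0 := by fun_prop
    have h2 : ContinuousAt (fun η : ℝ => (|a| + η) * (|b| + η) / |b|) 0 := by fun_prop
    have h3 : ContinuousAt (fun η : ℝ =>
        ((|a| + η) * (|b| + η) / |b|) ^ (1 - β) * ((|b| + η) ^ 2 / |b|) ^ β) 0 := by
      refine (h2.rpow_const (Or.inl ?_)).mul (ContinuousAt.rpow_const (by fun_prop) (Or.inl ?_))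
      · simp only [add_zero]; positivity
      · simp only [add_zero]; positivity
    have e1 := h1.eventually_lt_const (show |a| + 0 < 1 by simpa using ha1)
    have e2 := h2.eventually_lt_const (show (|a| + 0) * (|b| + 0) / |b| < 1 by
      rw [add_zero, add_zero, mul_div_cancel_right₀ _ hb0.ne']; exact ha1)
    have e3 := h3.eventually_lt_const (show
      ((|a| + 0) * (|b| + 0) / |b|) ^ (1 - β) * ((|b| + 0) ^ 2 / |b|) ^ β < 1 by
        rw [add_zero, add_zero, mul_div_cancel_right₀ _ hb0.ne', sq,
          mul_div_cancel_right₀ _ hb0.ne']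
        exact hrate)
    have e4 : ∀ᶠ η : ℝ in 𝓝[>] 0, |a| + η < 1 ∧ (|a| + η) * (|b| + η) / |b| < 1 ∧
      ((|a| + η) * (|b| + η) / |b|) ^ (1 - β) * ((|b| + η) ^ 2 / |b|) ^ β < 1 :=
      nhdsWithin_le_nhds (e1.and (e2.and e3))
    obtain ⟨η, h, h'⟩ := (e4.and self_mem_nhdsWithin).exists
    exact ⟨η, h', h⟩
  obtain ⟨g, g', K, hK, hg, hgη, hgK, hgF, hgs⟩ := exists_global_extension hF hA hη hδ
  have hg0 : ∀ y, g (0, y) = 0 := by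
    intro y
    obtain ⟨s, hs, h⟩ := hgs (0, y)
    have h1 : s * y ∈ ball (0 : ℝ) δ := by
      rw [mem_ball_zero_iff]
      refine lt_of_le_of_lt ?_ hs
      rw [Prod.norm_def]; simp
    have h2 : s • ((0, y) : ℝ × ℝ) = (0, s * y) := by simp
    rw [h, h2, hδF _ h1]
    simp
  have hbd := fun z v => bounds_of_vanishing_on_axis hK hg hgη hgK hg0 z v
  set G : ℝ × ℝ → ℝ × ℝ := fun z => diagCLM a b z + g z with hG
  have hgd0 : g' 0 = 0 := by
    -- `F` and its extension have the same derivative at the origin.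
    have h1 : HasFDerivAt F (diagCLM a b + g' 0) 0 :=
      ((diagCLM a b).hasFDerivAt.add (hg 0)).congr_of_eventuallyEq (hgF.mono fun z hz => hz.symm)
    simpa using h1.unique hA
  have hle : |a| ≤ |b| := (ha1.trans hb).le
  obtain ⟨ψ, hψ, hψ0, hψd, hψG⟩ := exists_solution_cohomological
    (F := G) (F' := fun z => diagCLM a b + g' z) (M := |b| + η) (K := K + η)
    (e := fun z => (g z).2) (e' := fun z => (ContinuousLinearMap.snd ℝ ℝ ℝ).comp (g' z))
    (p := ContinuousLinearMap.fst ℝ ℝ ℝ) (θ := |a| + η) (μ := b) (β := β)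
    (by linarith) (by positivity) hη1 (by positivity) hβ0 hβ1 hb0 hη2 hη3
    (fun z => (diagCLM a b).hasFDerivAt.add (hg z))
    (fun z => (norm_add_le _ _).trans (add_le_add (norm_diagCLM_le hle) (hgη z)))
    (fun z w => by
      rw [add_sub_add_left_eq_sub]
      exact (hgK z w).trans (mul_le_mul_of_nonneg_right (by linarith) (norm_nonneg _)))
    (fun z => by
      have h1 := (norm_fst_le (g z)).trans (hbd z 0).1
      rw [Real.norm_eq_abs] at h1
      simp only [hG, ContinuousLinearMap.coe_fst', Prod.fst_add, diagCLM_apply]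
      have h2 := abs_add_le (a * z.1) (g z).1
      rw [abs_mul] at h2
      linarith)
    (fun z v => by
      have h1 := (norm_fst_le (g' z v)).trans (hbd z v).2
      rw [Real.norm_eq_abs] at h1
      simp only [ContinuousLinearMap.coe_fst', add_apply, Prod.fst_add,
        diagCLM_apply]
      have h2 := abs_add_le (a * v.1) (g' z v).1
      rw [abs_mul] at h2
      have h3 : 0 ≤ η * |z.1| * ‖v‖ := by positivity
      linarith)
    (fun z => (ContinuousLinearMap.snd ℝ ℝ ℝ).hasFDerivAt.comp z (hg z))
    (fun z w => by
      have h1 : (ContinuousLinearMap.snd ℝ ℝ ℝ).comp (g' z)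
          - (ContinuousLinearMap.snd ℝ ℝ ℝ).comp (g' w)
          = (ContinuousLinearMap.snd ℝ ℝ ℝ).comp (g' z - g' w) := by
        rw [ContinuousLinearMap.comp_sub]
      rw [h1]
      refine (ContinuousLinearMap.opNorm_comp_le _ _).trans ?_
      refine (mul_le_mul (ContinuousLinearMap.norm_snd_le ℝ ℝ ℝ) (hgK z w) (norm_nonneg _)
        zero_le_one).trans ?_
      rw [one_mul]
      exact mul_le_mul_of_nonneg_right (by linarith) (norm_nonneg _))
    (fun z v => by
      have h1 := (norm_snd_le (g' z v)).trans (hbd z v).2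
      rw [Real.norm_eq_abs] at h1
      simp only [ContinuousLinearMap.coe_fst', ContinuousLinearMap.comp_apply,
        ContinuousLinearMap.coe_snd']
      have h3 : 0 ≤ η * |z.1| * ‖v‖ := by positivity
      have h4 : 0 ≤ K * |v.1| := by positivity
      linarith)
    (by simp [hG, show g 0 = 0 from hg0 0]) (by simp [show g 0 = 0 from hg0 0]) (by simp [hgd0])
  have hslab : {z : ℝ × ℝ | |ContinuousLinearMap.fst ℝ ℝ ℝ z| < 1} ∈ 𝓝 (0 : ℝ × ℝ) := by
    refine (isOpen_lt (by fun_prop) continuous_const).mem_nhds ?_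
    simp
  obtain ⟨r, hr, hrs⟩ := Metric.mem_nhds_iff.1 hslab
  have hψat : C1HolderAt β ψ 0 := ⟨r, hr, hψ.mono hrs⟩
  refine ⟨fun z => ContinuousLinearMap.snd ℝ ℝ ℝ z + ψ z,
    ((ContinuousLinearMap.snd ℝ ℝ ℝ).c1HolderAt hβ0 0).add hβ0 hψat, by simp [hψ0], ?_, ?_⟩
  · have h1 := hψat.hasFDerivAt hβ0
    rw [hψd] at h1
    have h2 := (ContinuousLinearMap.snd ℝ ℝ ℝ).hasFDerivAt.add h1
    rw [add_zero] at h2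
    exact h2
  · filter_upwards [hgF, hslab] with z hz hz1
    have h1 := hψG z hz1
    rw [← hz, h1]
    simp only [ContinuousLinearMap.coe_snd', Prod.snd_add, diagCLM_apply]
    ring

/-- A planar `C^{1,1}` saddle has a function `φ` of class `C^{1,β}` with `φ ∘ F = b φ`, where `b` is
the expanding eigenvalue, provided `|a| ^ (1 - β) |b| ^ β < 1`. The coordinates are adapted to the
linearized unstable curve, which reduces the claim to the straightened case. -/
theorem exists_linearizing_coordinate {a b β : ℝ} {F : ℝ × ℝ → ℝ × ℝ}
    (hF : C1HolderAt 1 F 0) (hF0 : F 0 = 0) (hA : HasFDerivAt F (diagCLM a b) 0)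
    (ha : 0 < |a|) (ha1 : |a| < 1) (hb : 1 < |b|) (hβ0 : 0 < β) (hβ1 : β ≤ 1)
    (hrate : |a| ^ (1 - β) * |b| ^ β < 1) :
    ∃ φ : ℝ × ℝ → ℝ, C1HolderAt β φ 0 ∧ φ 0 = 0 ∧
      HasFDerivAt φ (ContinuousLinearMap.snd ℝ ℝ ℝ) 0 ∧ ∀ᶠ z in 𝓝 0, φ (F z) = b * φ z := by
  have hη : 0 < (b ^ 2 - |b|) / 2 := by
    have : b ^ 2 = |b| ^ 2 := (sq_abs b).symm
    nlinarith
  obtain ⟨g, g', K, hK, hg, hgη, hgK, hgF, hgs⟩ := exists_global_extension hF hA hη one_pos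
  have hG0 : diagCLM a b 0 + g 0 = 0 := hgF.self_of_nhds.trans hF0
  have hgd0 : g' 0 = 0 := by
    have h1 : HasFDerivAt F (diagCLM a b + g' 0) 0 :=
      ((diagCLM a b).hasFDerivAt.add (hg 0)).congr_of_eventuallyEq (hgF.mono fun z hz => hz.symm)
    simpa using h1.unique hA
  have hle : |a| ≤ |b| := (ha1.trans hb).le
  obtain ⟨γ, hγ, hγ0, hγd, hγF⟩ := exists_linearized_curve (u := ((0, 1) : ℝ × ℝ))
    (F := fun z => diagCLM a b z + g z) (F' := fun z => diagCLM a b + g' z)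
    (M := |b| + (b ^ 2 - |b|) / 2) hK hb (by linarith)
    (fun z => (diagCLM a b).hasFDerivAt.add (hg z))
    (fun z => (norm_add_le _ _).trans (add_le_add (norm_diagCLM_le hle) (hgη z)))
    (fun z w => by rw [add_sub_add_left_eq_sub]; exact hgK z w) hG0 (by simp [hgd0])
  have hγc : Tendsto γ (𝓝 0) (𝓝 0) := by
    simpa [ContinuousAt, hγ0] using hγd.continuousAt
  have hγF' : ∀ᶠ t in 𝓝 (0 : ℝ), F (γ t) = γ (b * t) := by
    filter_upwards [hγF, hγc.eventually hgF] with t h1 h2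
    rw [← h2, h1]
  -- Coordinates in which the unstable curve is the `y`-axis.
  let H : ℝ × ℝ → ℝ × ℝ := fun z =>
    γ (ContinuousLinearMap.snd ℝ ℝ ℝ z)
      + ((ContinuousLinearMap.inl ℝ ℝ ℝ).comp (ContinuousLinearMap.fst ℝ ℝ ℝ)) z
  have hH0 : H 0 = 0 := by simp [H, hγ0]
  have hH : C1HolderAt 1 H 0 :=
    (C1HolderAt.comp one_pos (by simpa using hγ)
      ((ContinuousLinearMap.snd ℝ ℝ ℝ).c1HolderAt one_pos 0)).add one_pos
      (ContinuousLinearMap.c1HolderAt _ one_pos 0)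
  have hHd : HasFDerivAt H ((ContinuousLinearEquiv.refl ℝ (ℝ × ℝ) : ℝ × ℝ →L[ℝ] ℝ × ℝ)) 0 := by
    have h1 : HasFDerivAt (fun z : ℝ × ℝ => γ (ContinuousLinearMap.snd ℝ ℝ ℝ z))
        ((ContinuousLinearMap.toSpanSingleton ℝ ((0, 1) : ℝ × ℝ)).comp
          (ContinuousLinearMap.snd ℝ ℝ ℝ)) 0 :=
      HasFDerivAt.comp (g := γ) 0 (by simpa using hγd) (ContinuousLinearMap.snd ℝ ℝ ℝ).hasFDerivAt
    refine (h1.add (ContinuousLinearMap.hasFDerivAt _)).congr_fderiv ?_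
    ext <;> simp
  obtain ⟨N, hN, hN0, hNd, hNH, hHN⟩ := hH.exists_inverse one_pos hHd
  rw [hH0] at hN hN0 hNd hHN
  have hHc : Tendsto H (𝓝 0) (𝓝 0) := by simpa [ContinuousAt, hH0] using hHd.continuousAt
  have hNc : Tendsto N (𝓝 0) (𝓝 0) := by simpa [ContinuousAt, hN0] using hNd.continuousAt
  have hFc : Tendsto F (𝓝 0) (𝓝 0) := by simpa [ContinuousAt, hF0] using hA.continuousAt
  have hFH : C1HolderAt 1 (fun z => F (H z)) 0 :=
    C1HolderAt.comp one_pos (by rw [hH0]; exact hF) hH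
  have hF₁ : C1HolderAt 1 (fun z => N (F (H z))) 0 :=
    C1HolderAt.comp one_pos (by rw [hH0, hF0]; exact hN) hFH
  have hF₁d : HasFDerivAt (fun z => N (F (H z))) (diagCLM a b) 0 := by
    have h1 : HasFDerivAt (fun z => F (H z)) _ 0 :=
      HasFDerivAt.comp (g := F) 0 (by rw [hH0]; exact hA) hHd
    have h2 := HasFDerivAt.comp (g := N) 0 (by rw [hH0, hF0]; exact hNd) h1
    refine h2.congr_fderiv ?_
    ext <;> simp
  have haxis : ∀ᶠ y in 𝓝 (0 : ℝ), N (F (H (0, y))) = (0, b * y) := by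
    have hc : ContinuousAt (fun y : ℝ => ((0, b * y) : ℝ × ℝ)) 0 := by fun_prop
    have hc' : Tendsto (fun y : ℝ => ((0, b * y) : ℝ × ℝ)) (𝓝 0) (𝓝 0) := by
      have := hc.tendsto; rw [mul_zero] at this; exact this
    filter_upwards [hγF', hc'.eventually hNH] with y h1 h2
    have h3 : ∀ t, H (0, t) = γ t := fun t => by simp [H]
    rw [h3] at h2 ⊢
    rw [h1, h2]
  obtain ⟨φ, hφ, hφ0, hφd, hφF⟩ := exists_linearizing_coordinate_of_straight hF₁ hF₁d ha ha1 hb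
    hβ0 hβ1 hrate haxis
  refine ⟨fun z => φ (N z), C1HolderAt.comp hβ0 (by rw [hN0]; exact hφ) (hN.of_one hβ1),
    by simp [hN0, hφ0], ?_, ?_⟩
  · have h1 := HasFDerivAt.comp (g := φ) 0 (by rw [hN0]; exact hφd) hNd
    refine h1.congr_fderiv ?_
    ext <;> simp
  · filter_upwards [hHN, hNc.eventually hφF] with z h1 h2
    rw [h1] at h2
    exact h2

variable {E : Type*} [NormedAddCommGroup E] [NormedSpace ℝ E]

/-- `exists_linearizing_coordinate` in a plane `E` with coordinates `T`. -/
theorem exists_linearizing_coordinate_of_equiv (T : E ≃L[ℝ] ℝ × ℝ) {A : E →L[ℝ] E} {a b β : ℝ}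
    {F : E → E} (hF : C1HolderAt 1 F 0) (hF0 : F 0 = 0) (hA : HasFDerivAt F A 0)
    (hT : ∀ v, T (A v) = (a * (T v).1, b * (T v).2))
    (ha : 0 < |a|) (ha1 : |a| < 1) (hb : 1 < |b|) (hβ0 : 0 < β) (hβ1 : β ≤ 1)
    (hrate : |a| ^ (1 - β) * |b| ^ β < 1) :
    ∃ φ : E → ℝ, C1HolderAt β φ 0 ∧ φ 0 = 0 ∧
      HasFDerivAt φ ((ContinuousLinearMap.snd ℝ ℝ ℝ).comp (T : E →L[ℝ] ℝ × ℝ)) 0 ∧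
      ∀ᶠ z in 𝓝 0, φ (F z) = b * φ z := by
  have h1 : C1HolderAt 1 (fun w : ℝ × ℝ => F ((T.symm : ℝ × ℝ →L[ℝ] E) w)) 0 :=
    C1HolderAt.comp one_pos (by simpa using hF) ((T.symm : ℝ × ℝ →L[ℝ] E).c1HolderAt one_pos 0)
  have h2 : C1HolderAt 1 (fun w : ℝ × ℝ =>
      (T : E →L[ℝ] ℝ × ℝ) (F ((T.symm : ℝ × ℝ →L[ℝ] E) w))) 0 :=
    C1HolderAt.comp one_pos ((T : E →L[ℝ] ℝ × ℝ).c1HolderAt one_pos _) h1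
  have h3 : HasFDerivAt (fun w : ℝ × ℝ =>
      (T : E →L[ℝ] ℝ × ℝ) (F ((T.symm : ℝ × ℝ →L[ℝ] E) w))) (diagCLM a b) 0 := by
    have h4 : HasFDerivAt (fun w : ℝ × ℝ => F ((T.symm : ℝ × ℝ →L[ℝ] E) w)) _ 0 :=
      HasFDerivAt.comp (g := F) 0 (by simpa using hA) (T.symm : ℝ × ℝ →L[ℝ] E).hasFDerivAt
    refine ((T : E →L[ℝ] ℝ × ℝ).hasFDerivAt.comp 0 h4).congr_fderiv ?_
    refine ContinuousLinearMap.ext fun v => ?_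
    simp [hT]
  obtain ⟨φ, hφ, hφ0, hφd, hφF⟩ := exists_linearizing_coordinate h2 (by simp [hF0]) h3 ha ha1 hb
    hβ0 hβ1 hrate
  refine ⟨fun z => φ ((T : E →L[ℝ] ℝ × ℝ) z), C1HolderAt.comp hβ0 (by simpa using hφ)
    ((T : E →L[ℝ] ℝ × ℝ).c1HolderAt hβ0 0), by simp [hφ0],
    HasFDerivAt.comp (g := φ) 0 (by simpa using hφd) (T : E →L[ℝ] ℝ × ℝ).hasFDerivAt, ?_⟩
  have hTc : Tendsto T (𝓝 0) (𝓝 0) := by simpa using (T.continuous.tendsto 0)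
  filter_upwards [hTc.eventually hφF] with z hz
  simpa using hz

/-- The linearization is assembled from a linearizing coordinate of `F` and one of the inverse germ
of `F`, whose expanding eigenvalue is the inverse of the contracting one of `F`. -/
theorem isC1HolderLinearizable_of_equiv [CompleteSpace E] (T : E ≃L[ℝ] ℝ × ℝ) {A : E →L[ℝ] E}
    {a b β : ℝ} {F : E → E} (hF : C1HolderAt 1 F 0) (hF0 : F 0 = 0) (hA : HasFDerivAt F A 0)
    (hT : ∀ v, T (A v) = (a * (T v).1, b * (T v).2))
    (ha : 0 < |a|) (ha1 : |a| < 1) (hb : 1 < |b|) (hβ0 : 0 < β) (hβ1 : β ≤ 1)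
    (hrate : |a| ^ (1 - β) * |b| ^ β < 1) (hrate' : |b⁻¹| ^ (1 - β) * |a⁻¹| ^ β < 1) :
    IsC1HolderLinearizable β F := by
  have ha0 : a ≠ 0 := abs_pos.1 ha
  have hb0 : b ≠ 0 := abs_pos.1 (one_pos.trans hb)
  have hA' : ∀ v, A v = T.symm (a * (T v).1, b * (T v).2) := fun v => by rw [← hT]; simp
  let B : E →L[ℝ] E := (T.symm : ℝ × ℝ →L[ℝ] E).comp ((diagCLM a⁻¹ b⁻¹).comp (T : E →L[ℝ] ℝ × ℝ))
  have hB : ∀ v, T (B v) = (a⁻¹ * (T v).1, b⁻¹ * (T v).2) := fun v => by simp [B]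
  let e : E ≃L[ℝ] E := ContinuousLinearEquiv.equivOfInverse A B
    (fun v => T.injective (by rw [hB, hT]; simp [ha0, hb0]))
    (fun v => T.injective (by rw [hT, hB]; simp [ha0, hb0]))
  obtain ⟨N, hN, hN0, hNd, hNF, -⟩ := hF.exists_inverse one_pos (A := e) hA
  rw [hF0] at hN hN0 hNd
  obtain ⟨φ₂, hφ₂, hφ₂0, hφ₂d, hφ₂F⟩ := exists_linearizing_coordinate_of_equiv T hF hF0 hA hT
    ha ha1 hb hβ0 hβ1 hrate
  obtain ⟨φ₁, hφ₁, hφ₁0, hφ₁d, hφ₁N⟩ := exists_linearizing_coordinate_of_equiv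
    (T.trans (ContinuousLinearEquiv.prodComm ℝ ℝ ℝ)) (a := b⁻¹) (b := a⁻¹) hN hN0 hNd
    (fun v => by
      change (T (B v)).swap = _
      rw [hB]; rfl)
    (by simpa using hb0) (by rw [abs_inv]; exact inv_lt_one_of_one_lt₀ hb)
    (by rw [abs_inv]; exact (one_lt_inv₀ ha).2 ha1) hβ0 hβ1 hrate'
  have hFc : Tendsto F (𝓝 0) (𝓝 0) := by simpa [ContinuousAt, hF0] using hA.continuousAt
  have hφ₁F : ∀ᶠ z in 𝓝 (0 : E), φ₁ (F z) = a * φ₁ z := by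
    filter_upwards [hNF, hFc.eventually hφ₁N] with z h1 h2
    rw [h1] at h2
    rw [h2]
    field_simp
  let I₁ : ℝ →L[ℝ] E := (T.symm : ℝ × ℝ →L[ℝ] E).comp (ContinuousLinearMap.inl ℝ ℝ ℝ)
  let I₂ : ℝ →L[ℝ] E := (T.symm : ℝ × ℝ →L[ℝ] E).comp (ContinuousLinearMap.inr ℝ ℝ ℝ)
  have hΨ : C1HolderAt β (fun z => I₁ (φ₁ z) + I₂ (φ₂ z)) 0 :=
    (C1HolderAt.comp hβ0 (I₁.c1HolderAt hβ0 _) hφ₁).add hβ0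
      (C1HolderAt.comp hβ0 (I₂.c1HolderAt hβ0 _) hφ₂)
  have hI : ∀ s t, I₁ s + I₂ t = T.symm (s, t) := by
    intro s t
    simp only [I₁, I₂, ContinuousLinearMap.comp_apply, ContinuousLinearMap.inl_apply,
      ContinuousLinearMap.inr_apply, ContinuousLinearEquiv.coe_coe]
    rw [← map_add]; simp
  have hΨd : HasFDerivAt (fun z => I₁ (φ₁ z) + I₂ (φ₂ z))
      ((ContinuousLinearEquiv.refl ℝ E : E ≃L[ℝ] E) : E →L[ℝ] E) 0 := by
    refine ((I₁.hasFDerivAt.comp 0 hφ₁d).add (I₂.hasFDerivAt.comp 0 hφ₂d)).congr_fderiv ?_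
    refine ContinuousLinearMap.ext fun v => ?_
    change I₁ (T v).swap.2 + I₂ (T v).2 = v
    rw [hI]
    simp
  have hconj : ∀ᶠ z in 𝓝 (0 : E),
      I₁ (φ₁ (F z)) + I₂ (φ₂ (F z)) = fderiv ℝ F 0 (I₁ (φ₁ z) + I₂ (φ₂ z)) := by
    filter_upwards [hφ₁F, hφ₂F] with z h1 h2
    rw [hA.fderiv, hA', hI, hI, h1, h2]
    simp
  obtain ⟨Φ, h0, hsub, hΦ, hΦ1, hΦ2⟩ := hΨ.exists_openPartialHomeomorph hβ0 hΨd hconj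
  refine ⟨Φ, h0, hΦ1, hΦ2, fun z hz _ => ?_⟩
  rw [hΦ, hΦ]
  exact hsub hz

end Planar

/-! ### Every planar `C^{1,1}` saddle is linearizable -/

section Exponent

theorem rpow_mul_rpow_lt_one {a b β : ℝ} (ha : 0 < a) (ha1 : a < 1) (hb : 1 < b)
    (hβ : β < Real.log a / (Real.log a - Real.log b)) : a ^ (1 - β) * b ^ β < 1 := by
  have hla := Real.log_neg ha ha1
  have hlb := Real.log_pos hb
  rw [lt_div_iff_of_neg (by linarith)] at hβ
  rw [Real.rpow_def_of_pos ha, Real.rpow_def_of_pos (one_pos.trans hb), ← Real.exp_add,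
    Real.exp_lt_one_iff]
  linarith

theorem saddleExponent_pos {l₁ l₂ : ℝ} (h₁ : 0 < |l₁|) (h₁' : |l₁| < 1) (h₂ : 1 < |l₂|) :
    0 < saddleExponent l₁ l₂ := by
  have hla := Real.log_neg h₁ h₁'
  have hlb := Real.log_pos h₂
  exact lt_min (div_pos_of_neg_of_neg hla (by linarith)) (div_pos hlb (by linarith))

theorem saddleExponent_le_one {l₁ l₂ : ℝ} (h₁ : 0 < |l₁|) (h₁' : |l₁| < 1) (h₂ : 1 < |l₂|) :
    saddleExponent l₁ l₂ ≤ 1 := by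
  have hla := Real.log_neg h₁ h₁'
  have hlb := Real.log_pos h₂
  refine (min_le_right _ _).trans ?_
  rw [div_le_one (by linarith)]
  linarith

end Exponent

theorem toEuclideanCLM_diagonal_apply (l : Fin 2 → ℝ) (v : EuclideanSpace ℝ (Fin 2)) (k : Fin 2) :
    Matrix.toEuclideanCLM (n := Fin 2) (𝕜 := ℝ) (Matrix.diagonal l) v k = l k * v k := by
  simp [Matrix.mulVec_diagonal]

theorem isC1HolderLinearizable_of_lt_saddleExponent {l₁ l₂ β : ℝ} (h₁ : 0 < |l₁|)
    (h₁' : |l₁| < 1) (h₂ : 1 < |l₂|) (hβ0 : 0 < β) (hβ : β < saddleExponent l₁ l₂)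
    {F : EuclideanSpace ℝ (Fin 2) → EuclideanSpace ℝ (Fin 2)}
    (hF : IsPlanarC11WithDiag l₁ l₂ F) : IsC1HolderLinearizable β F := by
  obtain ⟨hF1, hF0, hFd⟩ := hF
  refine isC1HolderLinearizable_of_equiv
    ((EuclideanSpace.equiv (Fin 2) ℝ).trans (ContinuousLinearEquiv.finTwoArrow ℝ ℝ))
    ⟨1, one_pos, hF1.mono (Set.subset_univ _)⟩ hF0 hFd (fun v => ?_) h₁ h₁' h₂ hβ0
    (hβ.le.trans (saddleExponent_le_one h₁ h₁' h₂))
    (rpow_mul_rpow_lt_one h₁ h₁' h₂ (hβ.trans_le (min_le_left _ _))) ?_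
  · exact Prod.ext (toEuclideanCLM_diagonal_apply ![l₁, l₂] v 0)
      (toEuclideanCLM_diagonal_apply ![l₁, l₂] v 1)
  · rw [abs_inv, abs_inv]
    refine rpow_mul_rpow_lt_one (by positivity) (inv_lt_one_of_one_lt₀ h₂)
      ((one_lt_inv₀ h₁).2 h₁') ?_
    have h := hβ.trans_le (min_le_right _ _)
    rw [Real.log_inv, Real.log_inv, sub_neg_eq_add, neg_add_eq_sub, ← neg_sub, neg_div_neg_eq]
    exact h

/-! ### A saddle with an obstruction -/

section Model

/-- Positively homogeneous extensions of Lipschitz maps on the unit ball are Lipschitz. -/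
theorem norm_homogeneous_sub_le {E G : Type*} [NormedAddCommGroup E] [NormedSpace ℝ E]
    [NormedAddCommGroup G] [NormedSpace ℝ G] {Q : E → G} {B L : ℝ}
    (hL : 0 ≤ L) (hB : ∀ u ∈ closedBall (0 : E) 1, ‖Q u‖ ≤ B)
    (hQ : ∀ u ∈ closedBall (0 : E) 1, ∀ v ∈ closedBall (0 : E) 1, ‖Q u - Q v‖ ≤ L * ‖u - v‖)
    (z w : E) :
    ‖‖z‖ • Q (‖z‖⁻¹ • z) - ‖w‖ • Q (‖w‖⁻¹ • w)‖ ≤ (B + L * 2) * ‖z - w‖ := by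
  have hunit : ∀ z : E, ‖z‖⁻¹ • z ∈ closedBall (0 : E) 1 := by
    intro z
    rw [mem_closedBall_zero_iff, norm_smul, norm_inv, norm_norm]
    exact inv_mul_le_one
  have hmul : ∀ z : E, ‖z‖ • ‖z‖⁻¹ • z = z := by
    intro z
    rcases eq_or_ne z 0 with rfl | hz
    · simp
    · rw [smul_smul, mul_inv_cancel₀ (norm_ne_zero_iff.2 hz), one_smul]
  set u := ‖z‖⁻¹ • z with hu
  set v := ‖w‖⁻¹ • w with hv
  have key : ‖z‖ • Q u - ‖w‖ • Q v = (‖z‖ - ‖w‖) • Q u + ‖w‖ • (Q u - Q v) := by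
    rw [sub_smul, smul_sub]; abel
  have h1 : ‖w‖ * ‖u - v‖ ≤ 2 * ‖z - w‖ := by
    have h2 : ‖w‖ • (u - v) = (‖w‖ - ‖z‖) • u + (z - w) := by
      rw [smul_sub, sub_smul, hu, hv, hmul, hmul]; abel
    have h3 : ‖‖w‖ • (u - v)‖ ≤ |‖w‖ - ‖z‖| * ‖u‖ + ‖z - w‖ := by
      rw [h2]
      refine (norm_add_le _ _).trans (add_le_add ?_ le_rfl)
      rw [norm_smul, Real.norm_eq_abs]
    rw [norm_smul, norm_norm] at h3
    have h4 := abs_norm_sub_norm_le w z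
    rw [norm_sub_rev] at h4
    have h5 : ‖u‖ ≤ 1 := mem_closedBall_zero_iff.1 (hunit z)
    nlinarith [abs_nonneg (‖w‖ - ‖z‖), norm_nonneg u]
  rw [key]
  calc _ ≤ |‖z‖ - ‖w‖| * ‖Q u‖ + ‖w‖ * ‖Q u - Q v‖ := by
        refine (norm_add_le _ _).trans_eq ?_
        rw [norm_smul, norm_smul, norm_norm, Real.norm_eq_abs]
    _ ≤ ‖z - w‖ * B + ‖w‖ * (L * ‖u - v‖) := by
        refine add_le_add (mul_le_mul (abs_norm_sub_norm_le z w) (hB _ (hunit z)) (norm_nonneg _)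
          (norm_nonneg _)) ?_
        exact mul_le_mul_of_nonneg_left (hQ _ (hunit z) _ (hunit w)) (norm_nonneg _)
    _ = ‖z - w‖ * B + L * (‖w‖ * ‖u - v‖) := by ring
    _ ≤ ‖z - w‖ * B + L * (2 * ‖z - w‖) := by gcongr
    _ = _ := by ring

/-- The Lipschitz function `h(x, y) = x² y² / (x² + y²) ^ (3/2)`, which vanishes on the axes and is
comparable to `min (|x|, |y|)` near the diagonals. -/
noncomputable def diagonalBump (z : EuclideanSpace ℝ (Fin 2)) : ℝ :=
  (z 0) ^ 2 * (z 1) ^ 2 / ‖z‖ ^ 3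

variable {i j : Fin 2}

theorem norm_sq_eq_of_ne (hij : i ≠ j) (z : EuclideanSpace ℝ (Fin 2)) :
    ‖z‖ ^ 2 = (z i) ^ 2 + (z j) ^ 2 := by
  rw [EuclideanSpace.norm_sq_eq, Fin.sum_univ_two]
  simp only [Real.norm_eq_abs, sq_abs]
  fin_cases i <;> fin_cases j <;> simp_all [add_comm]

theorem diagonalBump_eq (hij : i ≠ j) (z : EuclideanSpace ℝ (Fin 2)) :
    diagonalBump z = (z i) ^ 2 * (z j) ^ 2 / ‖z‖ ^ 3 := by
  unfold diagonalBump
  fin_cases i <;> fin_cases j <;> simp_all [mul_comm]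

theorem diagonalBump_nonneg (z : EuclideanSpace ℝ (Fin 2)) : 0 ≤ diagonalBump z := by
  unfold diagonalBump; positivity

theorem diagonalBump_le (hij : i ≠ j) (z : EuclideanSpace ℝ (Fin 2)) :
    diagonalBump z ≤ |z j| := by
  rw [diagonalBump_eq hij]
  have h := norm_sq_eq_of_ne hij z
  have hi : |z i| ≤ ‖z‖ := abs_le_of_sq_le_sq' (by nlinarith [sq_nonneg (z j)]) (norm_nonneg _) |>
    abs_le.2
  have hj : |z j| ≤ ‖z‖ := abs_le_of_sq_le_sq' (by nlinarith [sq_nonneg (z i)]) (norm_nonneg _) |>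
    abs_le.2
  refine div_le_of_le_mul₀ (by positivity) (abs_nonneg _) ?_
  calc (z i) ^ 2 * (z j) ^ 2 = |z j| * (|z i| ^ 2 * |z j|) := by
        rw [← sq_abs (z i), ← sq_abs (z j)]; ring
    _ ≤ |z j| * (‖z‖ ^ 2 * ‖z‖) := by gcongr
    _ = _ := by ring

theorem le_diagonalBump (hij : i ≠ j) {z : EuclideanSpace ℝ (Fin 2)} {t B : ℝ} (ht : 0 < t)
    (hB : 0 < B) (hi : t ≤ |z i|) (hj : t ≤ |z j|) (hi' : |z i| ≤ B * t) (hj' : |z j| ≤ B * t) :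
    t / (8 * B ^ 3) ≤ diagonalBump z := by
  rw [diagonalBump_eq hij]
  have h := norm_sq_eq_of_ne hij z
  have hz : ‖z‖ ≤ 2 * (B * t) := by
    refine abs_le_of_sq_le_sq' ?_ (by positivity) |>.2
    rw [h, ← sq_abs (z i), ← sq_abs (z j)]
    nlinarith [abs_nonneg (z i), abs_nonneg (z j)]
  have hz0 : 0 < ‖z‖ := by
    rw [norm_pos_iff]
    rintro rfl
    simp at hi
    linarith
  rw [div_le_div_iff₀ (by positivity) (by positivity)]
  calc t * ‖z‖ ^ 3 ≤ t * (2 * (B * t)) ^ 3 := by gcongr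
    _ = t ^ 2 * t ^ 2 * (8 * B ^ 3) := by ring
    _ ≤ |z i| ^ 2 * |z j| ^ 2 * (8 * B ^ 3) := by gcongr
    _ = _ := by rw [sq_abs, sq_abs]

/-- The gradient of `z ↦ z i * diagonalBump z` on the unit circle, as a polynomial. -/
noncomputable def bumpGradient (i j : Fin 2) (u : EuclideanSpace ℝ (Fin 2)) :
    EuclideanSpace ℝ (Fin 2) →L[ℝ] ℝ :=
  (3 * (u i) ^ 2 * (u j) ^ 4) • EuclideanSpace.proj (𝕜 := ℝ) i
    + (2 * (u i) ^ 3 * u j - 3 * (u i) ^ 3 * (u j) ^ 3) • EuclideanSpace.proj (𝕜 := ℝ) j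

theorem hasFDerivAt_mul_diagonalBump (hij : i ≠ j) (z : EuclideanSpace ℝ (Fin 2)) :
    HasFDerivAt (fun z : EuclideanSpace ℝ (Fin 2) => z i * diagonalBump z)
      (‖z‖ • bumpGradient i j (‖z‖⁻¹ • z)) z := by
  have hcoord : ∀ (w : EuclideanSpace ℝ (Fin 2)), |w i| ≤ ‖w‖ := fun w =>
    abs_le.2 (abs_le_of_sq_le_sq' (by nlinarith [sq_nonneg (w j), norm_sq_eq_of_ne hij w])
      (norm_nonneg _))
  have hcoord' : ∀ (w : EuclideanSpace ℝ (Fin 2)), |w j| ≤ ‖w‖ := fun w =>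
    abs_le.2 (abs_le_of_sq_le_sq' (by nlinarith [sq_nonneg (w i), norm_sq_eq_of_ne hij w])
      (norm_nonneg _))
  rcases eq_or_ne z 0 with rfl | hz
  · rw [norm_zero, zero_smul]
    refine Asymptotics.IsBigO.hasFDerivAt (n := 2) ?_ one_lt_two
    refine Asymptotics.IsBigO.of_bound 1 (Eventually.of_forall fun w => ?_)
    rw [sub_zero, one_mul, norm_mul, norm_pow, norm_norm, Real.norm_eq_abs, Real.norm_eq_abs,
      abs_of_nonneg (diagonalBump_nonneg w), sq]
    exact mul_le_mul (hcoord w) ((diagonalBump_le hij w).trans (hcoord' w))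
      (diagonalBump_nonneg w) (norm_nonneg _)
  · have hr : 0 < ‖z‖ := norm_pos_iff.2 hz
    have hn : ∀ w : EuclideanSpace ℝ (Fin 2), √((w i) ^ 2 + (w j) ^ 2) = ‖w‖ := fun w => by
      rw [← norm_sq_eq_of_ne hij, Real.sqrt_sq (norm_nonneg _)]
    have hs := norm_sq_eq_of_ne hij z
    have hs0 : (z i) ^ 2 + (z j) ^ 2 ≠ 0 := by rw [← hs]; positivity
    have hpi : HasFDerivAt (fun w : EuclideanSpace ℝ (Fin 2) => w i)
      (EuclideanSpace.proj (𝕜 := ℝ) i) z := (EuclideanSpace.proj (𝕜 := ℝ) i).hasFDerivAt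
    have hpj : HasFDerivAt (fun w : EuclideanSpace ℝ (Fin 2) => w j)
      (EuclideanSpace.proj (𝕜 := ℝ) j) z := (EuclideanSpace.proj (𝕜 := ℝ) j).hasFDerivAt
    have h1 : HasDerivAt (fun t : ℝ => (√t ^ 3)⁻¹) (-(3 / 2) / ‖z‖ ^ 5)
        ((z i) ^ 2 + (z j) ^ 2) := by
      have h0 : √((z i) ^ 2 + (z j) ^ 2) ^ 3 ≠ 0 := by rw [hn]; positivity
      refine (((Real.hasDerivAt_sqrt hs0).pow 3).inv h0).congr_deriv ?_
      simp only [Pi.pow_apply, hn]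
      field_simp
      ring
    have h2 := h1.comp_hasFDerivAt z ((hpi.pow 2).add (hpj.pow 2))
    have h3 := ((hpi.pow 3).mul (hpj.pow 2)).mul h2
    have hfun : (fun z : EuclideanSpace ℝ (Fin 2) => z i * diagonalBump z)
        = fun w => (w i) ^ 3 * (w j) ^ 2 * (√((w i) ^ 2 + (w j) ^ 2) ^ 3)⁻¹ := by
      funext w
      rw [diagonalBump_eq hij, hn]
      ring
    rw [hfun]
    refine h3.congr_fderiv ?_
    refine ContinuousLinearMap.ext fun v => ?_
    simp [bumpGradient, hn]
    field_simp
    linear_combination (3 * (z i) ^ 2 * (z j) ^ 2 * v i) * hs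

theorem exists_lipschitz_bumpGradient (i j : Fin 2) : ∃ C ≥ 0,
    ∀ z w : EuclideanSpace ℝ (Fin 2), ‖‖z‖ • bumpGradient i j (‖z‖⁻¹ • z)
      - ‖w‖ • bumpGradient i j (‖w‖⁻¹ • w)‖ ≤ C * ‖z - w‖ := by
  have hsmooth : ContDiff ℝ 1 (bumpGradient i j) := by
    have hi : ContDiff ℝ 1 (fun u : EuclideanSpace ℝ (Fin 2) => u i) :=
      (EuclideanSpace.proj (𝕜 := ℝ) i).contDiff
    have hj : ContDiff ℝ 1 (fun u : EuclideanSpace ℝ (Fin 2) => u j) :=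
      (EuclideanSpace.proj (𝕜 := ℝ) j).contDiff
    unfold bumpGradient
    fun_prop
  obtain ⟨L, hL⟩ := hsmooth.contDiffOn.exists_lipschitzOnWith one_ne_zero
    (convex_closedBall (0 : EuclideanSpace ℝ (Fin 2)) 1) (isCompact_closedBall _ _)
  obtain ⟨B, hB⟩ := (isCompact_closedBall (0 : EuclideanSpace ℝ (Fin 2)) 1).exists_bound_of_continuousOn
    hsmooth.continuous.continuousOn
  have hB0 : 0 ≤ B := (norm_nonneg _).trans (hB 0 (mem_closedBall_self zero_le_one))
  refine ⟨B + L * 2, by positivity, fun z w => norm_homogeneous_sub_le L.2 hB ?_ z w⟩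
  intro u hu v hv
  have := hL.dist_le_mul u hu v hv
  rwa [dist_eq_norm, dist_eq_norm] at this

/-- The planar saddle with eigenvalues `l 0`, `l 1` whose `i`-th coordinate is multiplied by
`l i * (1 + diagonalBump z)` and whose other coordinate is linear. -/
noncomputable def bumpSaddle (l : Fin 2 → ℝ) (i : Fin 2) (z : EuclideanSpace ℝ (Fin 2)) :
    EuclideanSpace ℝ (Fin 2) :=
  Matrix.toEuclideanCLM (n := Fin 2) (𝕜 := ℝ) (Matrix.diagonal l) z
    + (l i * (z i * diagonalBump z)) • EuclideanSpace.single i (1 : ℝ)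

variable (l : Fin 2 → ℝ)

theorem bumpSaddle_apply_self (i : Fin 2) (z : EuclideanSpace ℝ (Fin 2)) :
    bumpSaddle l i z i = l i * z i * (1 + diagonalBump z) := by
  rw [bumpSaddle, PiLp.add_apply, toEuclideanCLM_diagonal_apply]
  simp
  ring

theorem bumpSaddle_apply_of_ne (hij : i ≠ j) (z : EuclideanSpace ℝ (Fin 2)) :
    bumpSaddle l i z j = l j * z j := by
  rw [bumpSaddle, PiLp.add_apply, toEuclideanCLM_diagonal_apply]
  simp [hij.symm]

theorem hasFDerivAt_bumpSaddle (hij : i ≠ j) (z : EuclideanSpace ℝ (Fin 2)) :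
    HasFDerivAt (bumpSaddle l i)
      (Matrix.toEuclideanCLM (n := Fin 2) (𝕜 := ℝ) (Matrix.diagonal l)
        + (l i • (‖z‖ • bumpGradient i j (‖z‖⁻¹ • z))).smulRight (EuclideanSpace.single i (1 : ℝ)))
      z :=
  (ContinuousLinearMap.hasFDerivAt _).add
    (((hasFDerivAt_mul_diagonalBump hij z).const_mul (l i)).smul_const _)

/-- On the axis where the `i`-th coordinate vanishes, the derivative is the linear part. -/
theorem hasFDerivAt_bumpSaddle_of_apply_eq_zero (hij : i ≠ j) {z : EuclideanSpace ℝ (Fin 2)}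
    (hz : z i = 0) :
    HasFDerivAt (bumpSaddle l i)
      (Matrix.toEuclideanCLM (n := Fin 2) (𝕜 := ℝ) (Matrix.diagonal l)) z := by
  refine (hasFDerivAt_bumpSaddle l hij z).congr_fderiv ?_
  have h0 : bumpGradient i j (‖z‖⁻¹ • z) = 0 := by simp [bumpGradient, hz]
  rw [h0]
  ext v
  simp

theorem bumpSaddle_zero (i : Fin 2) : bumpSaddle l i 0 = 0 := by
  simp [bumpSaddle]

theorem isC1HolderOn_bumpSaddle (hij : i ≠ j) : IsC1HolderOn 1 (bumpSaddle l i) Set.univ := by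
  obtain ⟨C, hC, hlip⟩ := exists_lipschitz_bumpGradient i j
  refine isC1HolderOn_of_hasFDerivAt (C := |l i| * C) one_pos isOpen_univ
    (fun z _ => hasFDerivAt_bumpSaddle l hij z) fun z _ w _ => ?_
  rw [add_sub_add_left_eq_sub, Real.rpow_one]
  have h1 : (l i • (‖z‖ • bumpGradient i j (‖z‖⁻¹ • z))).smulRight
        (EuclideanSpace.single i (1 : ℝ))
      - (l i • (‖w‖ • bumpGradient i j (‖w‖⁻¹ • w))).smulRight (EuclideanSpace.single i (1 : ℝ))
      = (l i • (‖z‖ • bumpGradient i j (‖z‖⁻¹ • z)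
        - ‖w‖ • bumpGradient i j (‖w‖⁻¹ • w))).smulRight (EuclideanSpace.single i (1 : ℝ)) := by
    refine ContinuousLinearMap.ext fun v => ?_
    simp only [ContinuousLinearMap.smulRight_apply, sub_apply, smul_apply]
    rw [← sub_smul, smul_sub]
  rw [h1, ContinuousLinearMap.norm_smulRight_apply, norm_smul, Real.norm_eq_abs, PiLp.norm_single,
    norm_one, mul_one, mul_assoc]
  exact mul_le_mul_of_nonneg_left (hlip z w) (abs_nonneg _)

end Model

/-! ### Scalar functional equations and growth estimates -/

section Scaling

variable {ψ : ℝ → ℝ} {α κ R t : ℝ}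

theorem tendsto_pow_mul_zero (hα : |α| < 1) (t : ℝ) :
    Tendsto (fun n : ℕ => α ^ n * t) atTop (𝓝 0) := by
  simpa using (tendsto_pow_atTop_nhds_zero_of_abs_lt_one hα).mul_const t

theorem apply_pow_mul (hα : |α| < 1) (h : ∀ t, |t| < R → ψ (α * t) = κ * ψ t) (ht : |t| < R)
    (n : ℕ) : |α ^ n * t| < R ∧ ψ (α ^ n * t) = κ ^ n * ψ t := by
  induction n with
  | zero => simpa using ht
  | succ n ih =>
    have h1 : α ^ (n + 1) * t = α * (α ^ n * t) := by ring
    rw [h1, h _ ih.1, ih.2]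
    refine ⟨?_, by ring⟩
    rw [abs_mul]
    exact (mul_le_of_le_one_left (abs_nonneg _) hα.le).trans_lt ih.1

theorem eq_zero_of_scaling (hα : |α| < 1) (hκ : 1 < |κ|) (hψ : ContinuousAt ψ 0)
    (h : ∀ t, |t| < R → ψ (α * t) = κ * ψ t) (ht : |t| < R) : ψ t = 0 := by
  have hκ0 : κ ≠ 0 := abs_pos.1 (one_pos.trans hκ)
  have h1 : Tendsto (fun n : ℕ => (κ⁻¹) ^ n * ψ (α ^ n * t)) atTop (𝓝 (0 * ψ 0)) := by
    refine (tendsto_pow_atTop_nhds_zero_of_abs_lt_one ?_).mul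
      (hψ.tendsto.comp (tendsto_pow_mul_zero hα t))
    rw [abs_inv]; exact inv_lt_one_of_one_lt₀ hκ
  rw [zero_mul] at h1
  refine tendsto_nhds_unique (tendsto_const_nhds.congr fun n => ?_) h1
  rw [(apply_pow_mul hα h ht n).2, ← mul_assoc, ← mul_pow, inv_mul_cancel₀ hκ0, one_pow, one_mul]

theorem eq_apply_zero_of_scaling (hα : |α| < 1) (hψ : ContinuousAt ψ 0)
    (h : ∀ t, |t| < R → ψ (α * t) = ψ t) (ht : |t| < R) : ψ t = ψ 0 := by
  have h1 := hψ.tendsto.comp (tendsto_pow_mul_zero hα t)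
  refine tendsto_nhds_unique (tendsto_const_nhds.congr fun n => ?_) h1
  have h2 := (apply_pow_mul (ψ := ψ) (κ := 1) hα (fun t ht => by rw [h t ht, one_mul]) ht n).2
  rw [Function.comp_apply, h2, one_pow, one_mul]

theorem eq_mul_of_scaling (hα0 : α ≠ 0) (hα : |α| < 1) {c : ℝ} (hψ : HasDerivAt ψ c 0)
    (hψ0 : ψ 0 = 0) (h : ∀ t, |t| < R → ψ (α * t) = α * ψ t) (ht : |t| < R) : ψ t = c * t := by
  rcases eq_or_ne t 0 with rfl | ht0
  · rw [hψ0, mul_zero]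
  have h1 := hasDerivAt_iff_tendsto_slope_zero.1 hψ
  have h2 : Tendsto (fun n : ℕ => α ^ n * t) atTop (𝓝[≠] 0) :=
    tendsto_nhdsWithin_iff.2 ⟨tendsto_pow_mul_zero hα t, Eventually.of_forall fun n =>
      mul_ne_zero (pow_ne_zero n hα0) ht0⟩
  have h3 : Tendsto (fun _ : ℕ => t⁻¹ * ψ t) atTop (𝓝 c) := by
    refine (h1.comp h2).congr fun n => ?_
    have h4 := (apply_pow_mul hα h ht n).2
    simp only [Function.comp_apply, zero_add, hψ0, sub_zero, smul_eq_mul]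
    rw [h4]
    field_simp
  have h4 := tendsto_nhds_unique tendsto_const_nhds h3
  rw [← h4]
  field_simp

end Scaling

section Product

/-- Perturbed geometric growth: if the total relative perturbation is at most `1`, the sequence
stays within a factor `3` of the geometric one, and differs from it at least by each of the
nonnegative relative perturbations. -/
theorem perturbed_geometric_bounds {w h : ℕ → ℝ} {ν : ℝ} {N : ℕ}
    (hw : ∀ k, w (k + 1) = ν * w k * (1 + h k)) (h0 : ∀ k, 0 ≤ h k)
    (hsum : ∑ k ∈ Finset.range N, h k ≤ 1) :
    (∀ k ≤ N, |ν| ^ k * |w 0| ≤ |w k| ∧ |w k| ≤ 3 * (|ν| ^ k * |w 0|)) ∧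
      ∀ k < N, |ν| ^ N * |w 0| * h k ≤ |w N - ν ^ N * w 0| := by
  have hprod : ∀ k, w k = ν ^ k * w 0 * ∏ m ∈ Finset.range k, (1 + h m) := by
    intro k
    induction k with
    | zero => simp
    | succ k ih => rw [hw, Finset.prod_range_succ, pow_succ]; nth_rw 1 [ih]; ring
  have h1 : ∀ k, 1 ≤ ∏ m ∈ Finset.range k, (1 + h m) := fun k =>
    Finset.one_le_prod fun m _ => by linarith [h0 m]
  have h3 : ∀ k ≤ N, ∏ m ∈ Finset.range k, (1 + h m) ≤ 3 := by
    intro k hk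
    calc ∏ m ∈ Finset.range k, (1 + h m) ≤ ∏ m ∈ Finset.range k, Real.exp (h m) := by
          refine Finset.prod_le_prod (fun m _ => by linarith [h0 m]) fun m _ => ?_
          rw [add_comm]; exact Real.add_one_le_exp _
      _ = Real.exp (∑ m ∈ Finset.range k, h m) := (Real.exp_sum _ _).symm
      _ ≤ Real.exp 1 := by
          refine Real.exp_le_exp.2 (le_trans ?_ hsum)
          exact Finset.sum_le_sum_of_subset_of_nonneg (Finset.range_mono hk) fun m _ _ => h0 m
      _ ≤ 3 := by linarith [Real.exp_one_lt_d9]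
  refine ⟨fun k hk => ?_, fun k hk => ?_⟩
  · have e : |w k| = |ν| ^ k * |w 0| * ∏ m ∈ Finset.range k, (1 + h m) := by
      rw [hprod k, abs_mul, abs_mul, abs_pow, abs_of_nonneg (zero_le_one.trans (h1 k))]
    have hnn : 0 ≤ |ν| ^ k * |w 0| := by positivity
    rw [e]
    exact ⟨le_mul_of_one_le_right hnn (h1 k), by nlinarith [h3 k hk]⟩
  · have e : w N - ν ^ N * w 0 = ν ^ N * w 0 * (∏ m ∈ Finset.range N, (1 + h m) - 1) := by
      rw [hprod N]; ring
    have h4 : 1 + h k ≤ ∏ m ∈ Finset.range N, (1 + h m) := by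
      rw [← Finset.mul_prod_erase _ _ (Finset.mem_range.2 hk)]
      refine le_mul_of_one_le_right (by linarith [h0 k]) ?_
      exact Finset.one_le_prod fun m _ => by linarith [h0 m]
    rw [e, abs_mul, abs_mul, abs_pow]
    refine mul_le_mul_of_nonneg_left ?_ (by positivity)
    exact (by linarith : h k ≤ _).trans (le_abs_self _)

theorem sum_range_pow_le {r : ℝ} (hr : 0 ≤ r) (hr1 : r < 1) (N : ℕ) :
    ∑ k ∈ Finset.range N, r ^ k ≤ (1 - r)⁻¹ := by
  rw [← tsum_geometric_of_lt_one hr hr1]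
  exact (summable_geometric_of_lt_one hr hr1).sum_le_tsum _ fun k _ => by positivity

theorem not_forall_exp_le {q a b c C D : ℝ} (hc : 0 < c) (ha : q < a) (hb : q < b)
    (h : ∀ᶠ N : ℕ in atTop, c * Real.exp (-(q * N)) ≤
      C * Real.exp (-(a * N)) + D * Real.exp (-(b * N))) : False := by
  have key : ∀ r : ℝ, 0 < r → Tendsto (fun N : ℕ => Real.exp (-(r * N))) atTop (𝓝 0) := by
    intro r hr
    refine Real.tendsto_exp_atBot.comp (tendsto_neg_atTop_atBot.comp ?_)
    exact tendsto_natCast_atTop_atTop.const_mul_atTop hr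
  have hlim := ((key (a - q) (sub_pos.2 ha)).const_mul C).add
    ((key (b - q) (sub_pos.2 hb)).const_mul D)
  have hle : ∀ᶠ N : ℕ in atTop, c ≤
      C * Real.exp (-((a - q) * N)) + D * Real.exp (-((b - q) * N)) := by
    filter_upwards [h] with N hN
    have h1 : ∀ r : ℝ, Real.exp (-((r - q) * N)) = Real.exp (-(r * N)) * Real.exp (q * N) := by
      intro r; rw [← Real.exp_add]; ring_nf
    have h2 := mul_le_mul_of_nonneg_right hN (Real.exp_pos (q * N)).le
    rw [mul_assoc, ← Real.exp_add, neg_add_cancel, Real.exp_zero, mul_one] at h2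
    rw [h1, h1]
    linarith
  have := ge_of_tendsto hlim hle
  simp at this
  linarith

end Product

/-! ### Sharpness of the exponent -/

section Sharpness

variable {i j : Fin 2}

/-- The point of the plane with `i`-th coordinate `u` and `j`-th coordinate `v`. -/
noncomputable def planePoint (i j : Fin 2) (u v : ℝ) : EuclideanSpace ℝ (Fin 2) :=
  EuclideanSpace.single i u + EuclideanSpace.single j v

theorem planePoint_apply_left (hij : i ≠ j) (u v : ℝ) : planePoint i j u v i = u := by
  simp [planePoint, hij]

theorem planePoint_apply_right (hij : i ≠ j) (u v : ℝ) : planePoint i j u v j = v := by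
  simp [planePoint, hij.symm]

theorem ext_of_ne (hij : i ≠ j) {z w : EuclideanSpace ℝ (Fin 2)} (hi : z i = w i)
    (hj : z j = w j) : z = w := by
  ext k
  fin_cases i <;> fin_cases j <;> fin_cases k <;> simp_all

theorem eq_planePoint (hij : i ≠ j) (z : EuclideanSpace ℝ (Fin 2)) :
    z = planePoint i j (z i) (z j) :=
  ext_of_ne hij (planePoint_apply_left hij _ _).symm (planePoint_apply_right hij _ _).symm

theorem norm_le_abs_add_abs (hij : i ≠ j) (z : EuclideanSpace ℝ (Fin 2)) :
    ‖z‖ ≤ |z i| + |z j| := by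
  refine abs_le_of_sq_le_sq' ?_ (by positivity) |>.2
  rw [norm_sq_eq_of_ne hij, ← sq_abs (z i), ← sq_abs (z j)]
  nlinarith [mul_nonneg (abs_nonneg (z i)) (abs_nonneg (z j))]

theorem norm_le_norm_of_abs_le (hij : i ≠ j) {z w : EuclideanSpace ℝ (Fin 2)}
    (hi : |z i| ≤ |w i|) (hj : |z j| ≤ |w j|) : ‖z‖ ≤ ‖w‖ := by
  refine abs_le_of_sq_le_sq' ?_ (norm_nonneg w) |>.2
  rw [norm_sq_eq_of_ne hij, norm_sq_eq_of_ne hij]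
  exact add_le_add (sq_le_sq.2 hi) (sq_le_sq.2 hj)

theorem norm_planePoint_zero_left (i j : Fin 2) (v : ℝ) : ‖planePoint i j 0 v‖ = |v| := by
  have h : EuclideanSpace.single i (0 : ℝ) = 0 := by ext k; simp
  rw [planePoint, h, zero_add, PiLp.norm_single, Real.norm_eq_abs]

theorem norm_planePoint_zero_right (i j : Fin 2) (u : ℝ) : ‖planePoint i j u 0‖ = |u| := by
  have h : EuclideanSpace.single j (0 : ℝ) = 0 := by ext k; simp
  rw [planePoint, h, add_zero, PiLp.norm_single, Real.norm_eq_abs]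

theorem hasDerivAt_planePoint_left (i j : Fin 2) (u v : ℝ) :
    HasDerivAt (fun u => planePoint i j u v) (EuclideanSpace.single i (1 : ℝ)) u := by
  have h1 : (fun u => planePoint i j u v)
      = fun u : ℝ => u • EuclideanSpace.single i (1 : ℝ) + EuclideanSpace.single j v := by
    funext u
    ext k
    simp [planePoint]
  rw [h1]
  simpa using ((hasDerivAt_id u).smul_const (EuclideanSpace.single i (1 : ℝ))).add_const
    (EuclideanSpace.single j v)

theorem continuous_planePoint_right (i j : Fin 2) (u : ℝ) :
    Continuous fun v => planePoint i j u v := by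
  have h1 : (fun v => planePoint i j u v)
      = fun v : ℝ => EuclideanSpace.single i u + v • EuclideanSpace.single j (1 : ℝ) := by
    funext v
    ext k
    simp [planePoint]
  rw [h1]
  fun_prop

/-- A coordinate of a linearization: a `C^{1,β}` germ with nonzero derivative that is multiplied by
the eigenvalue `l i` under the map. -/
theorem IsC1HolderLinearizable.exists_coordinate {β : ℝ} (hβ : 0 < β) {l : Fin 2 → ℝ} {i : Fin 2}
    {F : EuclideanSpace ℝ (Fin 2) → EuclideanSpace ℝ (Fin 2)}
    (hF : HasFDerivAt F (Matrix.toEuclideanCLM (n := Fin 2) (𝕜 := ℝ) (Matrix.diagonal l)) 0)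
    (h : IsC1HolderLinearizable β F) :
    ∃ φ : EuclideanSpace ℝ (Fin 2) → ℝ, C1HolderAt β φ 0 ∧ fderiv ℝ φ 0 ≠ 0 ∧
      ∃ R > 0, ∀ z ∈ ball (0 : EuclideanSpace ℝ (Fin 2)) R,
        F z ∈ ball (0 : EuclideanSpace ℝ (Fin 2)) R → φ (F z) = l i * φ z := by
  obtain ⟨Φ, h0, hΦ, hΦs, hconj⟩ := h
  obtain ⟨R, hR, hRs⟩ := Metric.isOpen_iff.1 Φ.open_source 0 h0
  have hΦat : C1HolderAt β Φ 0 := ⟨R, hR, hΦ.mono hRs⟩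
  have hd := hΦat.hasFDerivAt hβ
  have hφd := (EuclideanSpace.proj (𝕜 := ℝ) i).hasFDerivAt.comp (0 : EuclideanSpace ℝ (Fin 2)) hd
  refine ⟨fun z => EuclideanSpace.proj (𝕜 := ℝ) i (Φ z), C1HolderAt.comp hβ
    (ContinuousLinearMap.c1HolderAt _ hβ _) hΦat, ?_, R, hR, ?_⟩
  · intro hzero
    have h1 : (EuclideanSpace.proj (𝕜 := ℝ) i).comp (fderiv ℝ Φ 0) = 0 := hφd.fderiv.symm.trans hzero
    have ht : Φ 0 ∈ Φ.target := Φ.map_source h0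
    obtain ⟨ρ, hρ, hρt⟩ := Metric.isOpen_iff.1 Φ.open_target _ ht
    have hsd := C1HolderAt.hasFDerivAt hβ ⟨ρ, hρ, hΦs.mono hρt⟩
    have h2 : HasFDerivAt (fun w => Φ (Φ.symm w)) ((fderiv ℝ Φ 0).comp (fderiv ℝ Φ.symm (Φ 0)))
        (Φ 0) := HasFDerivAt.comp (g := Φ) (Φ 0) (by rw [Φ.left_inv h0]; exact hd) hsd
    have h3 : HasFDerivAt (fun w => Φ (Φ.symm w))
        (ContinuousLinearMap.id ℝ (EuclideanSpace ℝ (Fin 2))) (Φ 0) := by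
      refine (hasFDerivAt_id (Φ 0)).congr_of_eventuallyEq ?_
      filter_upwards [Φ.open_target.mem_nhds ht] with w hw using Φ.right_inv hw
    have h4 := h2.unique h3
    have h5 : EuclideanSpace.proj (𝕜 := ℝ) i (EuclideanSpace.single i (1 : ℝ)) = 0 := by
      calc _ = EuclideanSpace.proj (𝕜 := ℝ) i
            (ContinuousLinearMap.id ℝ (EuclideanSpace ℝ (Fin 2)) (EuclideanSpace.single i 1)) := rfl
        _ = ((EuclideanSpace.proj (𝕜 := ℝ) i).comp (fderiv ℝ Φ 0))
            (fderiv ℝ Φ.symm (Φ 0) (EuclideanSpace.single i 1)) := by rw [← h4]; rfl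
        _ = 0 := by rw [h1]; rfl
    simp at h5
  · intro z hz hFz
    change Φ (F z) i = l i * Φ z i
    rw [hconj z (hRs hz) (hRs hFz), hF.fderiv, toEuclideanCLM_diagonal_apply]

variable {l : Fin 2 → ℝ}

theorem bumpSaddle_planePoint_zero_left (hij : i ≠ j) (t : ℝ) :
    bumpSaddle l i (planePoint i j 0 t) = planePoint i j 0 (l j * t) := by
  refine ext_of_ne hij ?_ ?_
  · rw [bumpSaddle_apply_self, planePoint_apply_left hij, planePoint_apply_left hij]
    ring
  · rw [bumpSaddle_apply_of_ne l hij, planePoint_apply_right hij, planePoint_apply_right hij]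

theorem bumpSaddle_planePoint_zero_right (hij : i ≠ j) (t : ℝ) :
    bumpSaddle l i (planePoint i j t 0) = planePoint i j (l i * t) 0 := by
  refine ext_of_ne hij ?_ ?_
  · have h := diagonalBump_le hij (planePoint i j t 0)
    rw [planePoint_apply_right hij, abs_zero] at h
    rw [bumpSaddle_apply_self, planePoint_apply_left hij, planePoint_apply_left hij,
      h.antisymm (diagonalBump_nonneg _)]
    ring
  · rw [bumpSaddle_apply_of_ne l hij, planePoint_apply_right hij, planePoint_apply_right hij,
      mul_zero]

/-- Functional equations on the axes for a linearizing coordinate `φ`. The numbers `α`, `κ` are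
`l j`, `l i` or their inverses, chosen such that `|α| < 1 < |κ|`. -/
theorem axis_relations (hij : i ≠ j) {α κ R : ℝ} (hα0 : α ≠ 0) (hα : |α| < 1) (hκ : 1 < |κ|)
    (hcase : (l j = α ∧ l i = κ) ∨ (l j = α⁻¹ ∧ l i = κ⁻¹))
    {φ : EuclideanSpace ℝ (Fin 2) → ℝ}
    (hφd : ∀ z ∈ ball (0 : EuclideanSpace ℝ (Fin 2)) R, HasFDerivAt φ (fderiv ℝ φ z) z)
    (hconj : ∀ z ∈ ball (0 : EuclideanSpace ℝ (Fin 2)) R,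
      bumpSaddle l i z ∈ ball (0 : EuclideanSpace ℝ (Fin 2)) R → φ (bumpSaddle l i z) = l i * φ z) :
    (∀ t, |t| < R → φ (planePoint i j 0 (α * t)) = κ * φ (planePoint i j 0 t)) ∧
    (∀ t, |t| < R → fderiv ℝ φ (planePoint i j 0 (α * t)) (EuclideanSpace.single i 1)
      = fderiv ℝ φ (planePoint i j 0 t) (EuclideanSpace.single i 1)) ∧
    (∀ t, |t| < R → φ (planePoint i j (κ⁻¹ * t) 0) = κ⁻¹ * φ (planePoint i j t 0)) := by
  have hκ0 : κ ≠ 0 := abs_pos.1 (one_pos.trans hκ)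
  have hκ1 : |κ⁻¹| < 1 := by rw [abs_inv]; exact inv_lt_one_of_one_lt₀ hκ
  have hli : l i ≠ 0 := by rcases hcase with h | h <;> rw [h.2] <;> simpa using hκ0
  have hmem : ∀ t : ℝ, |t| < R → planePoint i j 0 t ∈ ball (0 : EuclideanSpace ℝ (Fin 2)) R :=
    fun t ht => by rwa [mem_ball_zero_iff, norm_planePoint_zero_left]
  have hmem' : ∀ t : ℝ, |t| < R → planePoint i j t 0 ∈ ball (0 : EuclideanSpace ℝ (Fin 2)) R :=
    fun t ht => by rwa [mem_ball_zero_iff, norm_planePoint_zero_right]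
  have hsmall : ∀ a t : ℝ, |a| < 1 → |t| < R → |a * t| < R := fun a t ha ht => by
    rw [abs_mul]
    exact (mul_le_of_le_one_left (abs_nonneg t) ha.le).trans_lt ht
  have base1 : ∀ t, |t| < R → |l j * t| < R →
      φ (planePoint i j 0 (l j * t)) = l i * φ (planePoint i j 0 t) := by
    intro t ht ht'
    rw [← bumpSaddle_planePoint_zero_left hij]
    exact hconj _ (hmem t ht) (by rw [bumpSaddle_planePoint_zero_left hij]; exact hmem _ ht')
  have base2 : ∀ t, |t| < R → |l j * t| < R →
      fderiv ℝ φ (planePoint i j 0 (l j * t)) (EuclideanSpace.single i 1)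
        = fderiv ℝ φ (planePoint i j 0 t) (EuclideanSpace.single i 1) := by
    intro t ht ht'
    have hF := hasFDerivAt_bumpSaddle_of_apply_eq_zero l hij
      (z := planePoint i j 0 t) (planePoint_apply_left hij 0 t)
    have hFz : bumpSaddle l i (planePoint i j 0 t) ∈ ball (0 : EuclideanSpace ℝ (Fin 2)) R := by
      rw [bumpSaddle_planePoint_zero_left hij]; exact hmem _ ht'
    have h1 := (hφd _ hFz).comp _ hF
    have h2 := (hφd _ (hmem t ht)).const_mul (l i)
    have hev : φ ∘ bumpSaddle l i =ᶠ[𝓝 (planePoint i j 0 t)] fun z => l i * φ z := by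
      filter_upwards [isOpen_ball.mem_nhds (hmem t ht),
        hF.continuousAt.preimage_mem_nhds (isOpen_ball.mem_nhds hFz)] with z hz hz'
      exact hconj z hz hz'
    have h3 := congrArg (fun L : EuclideanSpace ℝ (Fin 2) →L[ℝ] ℝ => L (EuclideanSpace.single i 1))
      ((h1.congr_of_eventuallyEq hev.symm).unique h2)
    have h4 : Matrix.toEuclideanCLM (n := Fin 2) (𝕜 := ℝ) (Matrix.diagonal l)
        (EuclideanSpace.single i 1) = l i • EuclideanSpace.single i (1 : ℝ) := by
      refine ext_of_ne hij ?_ ?_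
      · rw [toEuclideanCLM_diagonal_apply]; simp
      · rw [toEuclideanCLM_diagonal_apply]; simp [hij.symm]
    simp only [ContinuousLinearMap.comp_apply, h4, map_smul, smul_apply, smul_eq_mul] at h3
    rw [bumpSaddle_planePoint_zero_left hij] at h3
    exact mul_left_cancel₀ hli h3
  have base3 : ∀ t, |t| < R → |l i * t| < R →
      φ (planePoint i j (l i * t) 0) = l i * φ (planePoint i j t 0) := by
    intro t ht ht'
    rw [← bumpSaddle_planePoint_zero_right hij]
    exact hconj _ (hmem' t ht) (by rw [bumpSaddle_planePoint_zero_right hij]; exact hmem' _ ht')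
  rcases hcase with ⟨hj, hi⟩ | ⟨hj, hi⟩
  · rw [hj] at base1 base2
    rw [hi] at base1 base3
    refine ⟨fun t ht => base1 t ht (hsmall α t hα ht), fun t ht => base2 t ht (hsmall α t hα ht),
      fun t ht => ?_⟩
    have h1 := base3 (κ⁻¹ * t) (hsmall _ t hκ1 ht) (by rwa [mul_inv_cancel_left₀ hκ0])
    rw [mul_inv_cancel_left₀ hκ0] at h1
    rw [h1, inv_mul_cancel_left₀ hκ0]
  · rw [hj] at base1 base2
    rw [hi] at base1 base3
    have hback : ∀ t, |t| < R → |α * t| < R ∧ |α⁻¹ * (α * t)| < R := fun t ht =>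
      ⟨hsmall α t hα ht, by rwa [inv_mul_cancel_left₀ hα0]⟩
    refine ⟨fun t ht => ?_, fun t ht => ?_, fun t ht => base3 t ht (hsmall _ t hκ1 ht)⟩
    · have h1 := base1 (α * t) (hback t ht).1 (hback t ht).2
      rw [inv_mul_cancel_left₀ hα0] at h1
      rw [h1, mul_inv_cancel_left₀ hκ0]
    · have h1 := base2 (α * t) (hback t ht).1 (hback t ht).2
      rw [inv_mul_cancel_left₀ hα0] at h1
      exact h1.symm

/-- A linearizing coordinate of class `C^{1,β}` agrees with `c z_i` up to `O(|z_j|)` and up to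
`O(|z_i| ^ (1 + β))`: it is linear on one axis, and on the other axis it vanishes and has constant
transversal derivative. -/
theorem coordinate_estimates (hij : i ≠ j) {α κ β R₀ : ℝ} (hβ : 0 < β) (hα0 : α ≠ 0)
    (hα : |α| < 1) (hκ : 1 < |κ|) (hcase : (l j = α ∧ l i = κ) ∨ (l j = α⁻¹ ∧ l i = κ⁻¹))
    {φ : EuclideanSpace ℝ (Fin 2) → ℝ} (hφ : C1HolderAt β φ 0) (hφ0 : fderiv ℝ φ 0 ≠ 0)
    (hR₀ : 0 < R₀) (hconj : ∀ z ∈ ball (0 : EuclideanSpace ℝ (Fin 2)) R₀,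
      bumpSaddle l i z ∈ ball (0 : EuclideanSpace ℝ (Fin 2)) R₀ → φ (bumpSaddle l i z) = l i * φ z) :
    ∃ R > 0, ∃ c ≠ 0, ∃ M ≥ 0, ∃ C ≥ 0,
      (∀ z ∈ ball (0 : EuclideanSpace ℝ (Fin 2)) R,
        bumpSaddle l i z ∈ ball (0 : EuclideanSpace ℝ (Fin 2)) R →
          φ (bumpSaddle l i z) = l i * φ z) ∧
      (∀ z ∈ ball (0 : EuclideanSpace ℝ (Fin 2)) R, |φ z - c * z i| ≤ M * |z j|) ∧
      ∀ z ∈ ball (0 : EuclideanSpace ℝ (Fin 2)) R, |φ z - c * z i| ≤ C * |z i| ^ β * |z i| := by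
  have hκ0 : κ ≠ 0 := abs_pos.1 (one_pos.trans hκ)
  have hκ1 : |κ⁻¹| < 1 := by rw [abs_inv]; exact inv_lt_one_of_one_lt₀ hκ
  obtain ⟨R₁, hR₁, C, hC, M, hM, hd, hb, hh, hl⟩ := hφ.exists_bounds hβ
  set R := min R₀ R₁ with hRdef
  have hR : 0 < R := lt_min hR₀ hR₁
  have hs₀ : ball (0 : EuclideanSpace ℝ (Fin 2)) R ⊆ ball 0 R₀ := ball_subset_ball (min_le_left _ _)
  have hs₁ : ball (0 : EuclideanSpace ℝ (Fin 2)) R ⊆ ball 0 R₁ :=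
    ball_subset_ball (min_le_right _ _)
  have hconj' : ∀ z ∈ ball (0 : EuclideanSpace ℝ (Fin 2)) R,
      bumpSaddle l i z ∈ ball (0 : EuclideanSpace ℝ (Fin 2)) R →
        φ (bumpSaddle l i z) = l i * φ z := fun z hz hz' => hconj z (hs₀ hz) (hs₀ hz')
  obtain ⟨rel1, rel2, rel3⟩ := axis_relations hij hα0 hα hκ hcase (fun z hz => hd z (hs₁ hz)) hconj'
  have hp0 : planePoint i j 0 0 = 0 := by
    rw [← norm_eq_zero, norm_planePoint_zero_left, abs_zero]
  have h0R : |(0 : ℝ)| < R := by rwa [abs_zero]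
  have hd0 := hd 0 (mem_ball_self hR₁)
  have hcd : ContinuousAt (fderiv ℝ φ) 0 := by
    obtain ⟨r, hr, hr'⟩ := hφ
    exact (hr'.1.contDiffAt (ball_mem_nhds 0 hr)).continuousAt_fderiv one_ne_zero
  set e : EuclideanSpace ℝ (Fin 2) := EuclideanSpace.single i 1 with he
  set c := fderiv ℝ φ 0 e with hc
  have hpc : ContinuousAt (fun t => planePoint i j 0 t) 0 :=
    (continuous_planePoint_right i j 0).continuousAt
  -- `φ` vanishes on the `j`-axis.
  have hzero : ∀ t, |t| < R → φ (planePoint i j 0 t) = 0 := fun t ht =>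
    eq_zero_of_scaling (ψ := fun t => φ (planePoint i j 0 t)) hα hκ
      (ContinuousAt.comp (g := φ) (by rw [hp0]; exact hd0.continuousAt) hpc) rel1 ht
  -- The transversal derivative is constant along the `j`-axis.
  have hconst : ∀ t, |t| < R → fderiv ℝ φ (planePoint i j 0 t) e = c := by
    intro t ht
    have h1 : ContinuousAt (fun t => fderiv ℝ φ (planePoint i j 0 t) e) 0 :=
      (ContinuousAt.comp (g := fderiv ℝ φ) (by rw [hp0]; exact hcd) hpc).clm_apply
        continuousAt_const
    have h2 := eq_apply_zero_of_scaling hα h1 rel2 ht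
    rw [h2, hp0]
  -- `φ` is linear on the `i`-axis.
  have hlin : ∀ t, |t| < R → φ (planePoint i j t 0) = c * t := by
    intro t ht
    have h1 : HasDerivAt (fun t => φ (planePoint i j t 0)) c 0 :=
      HasFDerivAt.comp_hasDerivAt (l := φ) 0 (by rw [hp0]; exact hd0)
        (hasDerivAt_planePoint_left i j 0 0)
    exact eq_mul_of_scaling (ψ := fun t => φ (planePoint i j t 0)) (inv_ne_zero hκ0) hκ1 h1
      (hzero 0 h0R) rel3 ht
  have hc0 : c ≠ 0 := by
    intro hc0
    apply hφ0
    have h1 : fderiv ℝ φ 0 (EuclideanSpace.single j 1) = 0 := by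
      have h2 : HasDerivAt (fun t => φ (planePoint j i t 0))
          (fderiv ℝ φ 0 (EuclideanSpace.single j 1)) 0 :=
        HasFDerivAt.comp_hasDerivAt (l := φ) 0
          (by rw [planePoint, add_comm, ← planePoint, hp0]; exact hd0)
          (hasDerivAt_planePoint_left j i 0 0)
      have h3 : (fun t => φ (planePoint j i t 0)) =ᶠ[𝓝 0] fun _ => 0 := by
        have h4 : ∀ᶠ t : ℝ in 𝓝 0, |t| < R :=
          (continuous_abs.tendsto (0 : ℝ)).eventually_lt_const h0R
        filter_upwards [h4] with t ht
        rw [planePoint, add_comm, ← planePoint]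
        exact hzero t ht
      exact h2.unique ((hasDerivAt_const (0 : ℝ) (0 : ℝ)).congr_of_eventuallyEq h3)
    refine ContinuousLinearMap.ext fun v => ?_
    have h2 : v = v i • e + v j • EuclideanSpace.single j (1 : ℝ) :=
      ext_of_ne hij (by simp [he, hij]) (by simp [he, hij.symm])
    rw [h2, map_add, map_smul, map_smul, h1, ← hc, hc0]
    simp
  refine ⟨R, hR, c, hc0, M, hM.le, C, hC, hconj', fun z hz => ?_, fun z hz => ?_⟩
  · have hzi : planePoint i j (z i) 0 ∈ ball (0 : EuclideanSpace ℝ (Fin 2)) R := by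
      rw [mem_ball_zero_iff] at hz ⊢
      refine (norm_le_norm_of_abs_le hij ?_ ?_).trans_lt hz
      · rw [planePoint_apply_left hij]
      · rw [planePoint_apply_right hij, abs_zero]; exact abs_nonneg _
    have hzi' : |z i| < R := by rwa [mem_ball_zero_iff, norm_planePoint_zero_right] at hzi
    have h1 := hl z (hs₁ hz) _ (hs₁ hzi)
    have h2 : z - planePoint i j (z i) 0 = planePoint i j 0 (z j) := by
      refine ext_of_ne hij ?_ ?_
      · rw [PiLp.sub_apply, planePoint_apply_left hij, planePoint_apply_left hij, sub_self]
      · rw [PiLp.sub_apply, planePoint_apply_right hij, planePoint_apply_right hij, sub_zero]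
    rwa [hlin _ hzi', h2, norm_planePoint_zero_left, Real.norm_eq_abs] at h1
  · -- Mean value inequality along the segment from the `j`-axis to `z`.
    have hmem : ∀ s : ℝ, |s| ≤ |z i| →
        planePoint i j s (z j) ∈ ball (0 : EuclideanSpace ℝ (Fin 2)) R := by
      intro s hs
      rw [mem_ball_zero_iff] at hz ⊢
      refine (norm_le_norm_of_abs_le hij ?_ ?_).trans_lt hz
      · rwa [planePoint_apply_left hij]
      · rw [planePoint_apply_right hij]
    have hzj : |z j| < R := by
      have := hmem 0 (by rw [abs_zero]; exact abs_nonneg _)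
      rwa [mem_ball_zero_iff, norm_planePoint_zero_left] at this
    have hder : ∀ s ∈ closedBall (0 : ℝ) |z i|, HasDerivWithinAt
        (fun s => φ (planePoint i j s (z j)) - c * s)
        (fderiv ℝ φ (planePoint i j s (z j)) e - c) (closedBall (0 : ℝ) |z i|) s := by
      intro s hs
      have hs' : |s| ≤ |z i| := by simpa using hs
      have h1 : HasDerivAt (fun s => φ (planePoint i j s (z j)))
          (fderiv ℝ φ (planePoint i j s (z j)) e) s :=
        HasFDerivAt.comp_hasDerivAt (l := φ) s (hd _ (hs₁ (hmem s hs')))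
          (hasDerivAt_planePoint_left i j s (z j))
      have h2 := h1.sub ((hasDerivAt_id s).const_mul c)
      rw [mul_one] at h2
      exact h2.hasDerivWithinAt
    have hbound : ∀ s ∈ closedBall (0 : ℝ) |z i|,
        ‖fderiv ℝ φ (planePoint i j s (z j)) e - c‖ ≤ C * |z i| ^ β := by
      intro s hs
      have hs' : |s| ≤ |z i| := by simpa using hs
      rw [← hconst _ hzj, ← sub_apply]
      have h2 : planePoint i j s (z j) - planePoint i j 0 (z j) = planePoint i j s 0 := by
        refine ext_of_ne hij ?_ ?_
        · simp only [PiLp.sub_apply, planePoint_apply_left hij, sub_zero]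
        · simp only [PiLp.sub_apply, planePoint_apply_right hij, sub_self]
      have h3 := hh _ (hs₁ (hmem s hs')) _
        (hs₁ (hmem 0 (by rw [abs_zero]; exact abs_nonneg _)))
      rw [h2, norm_planePoint_zero_right] at h3
      have h4 : ‖e‖ = 1 := by rw [he, PiLp.norm_single, norm_one]
      refine (ContinuousLinearMap.le_opNorm _ _).trans ?_
      rw [h4, mul_one]
      exact h3.trans (mul_le_mul_of_nonneg_left
        (Real.rpow_le_rpow (abs_nonneg _) hs' hβ.le) hC)
    have h1 := Convex.norm_image_sub_le_of_norm_hasDerivWithin_le hder hbound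
      (convex_closedBall _ _) (mem_closedBall_self (abs_nonneg (z i)))
      (show z i ∈ closedBall (0 : ℝ) |z i| by simp)
    rw [hzero _ hzj, ← eq_planePoint hij] at h1
    simpa using h1

theorem bumpSaddle_orbit (hij : i ≠ j) {z : EuclideanSpace ℝ (Fin 2)} {N : ℕ} {s R : ℝ}
    {φ : EuclideanSpace ℝ (Fin 2) → ℝ}
    (hsum : ∑ k ∈ Finset.range N, |l j| ^ k * |z j| ≤ 1)
    (hx : ∀ k ≤ N, |l j| ^ k * |z j| ≤ s) (hy : ∀ k ≤ N, |l i| ^ k * |z i| ≤ s) (hsR : 4 * s < R)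
    (hconj : ∀ z ∈ ball (0 : EuclideanSpace ℝ (Fin 2)) R,
      bumpSaddle l i z ∈ ball (0 : EuclideanSpace ℝ (Fin 2)) R → φ (bumpSaddle l i z) = l i * φ z) :
    (∀ k, |(bumpSaddle l i)^[k] z j| = |l j| ^ k * |z j|) ∧
    (∀ k ≤ N, |l i| ^ k * |z i| ≤ |(bumpSaddle l i)^[k] z i| ∧
      |(bumpSaddle l i)^[k] z i| ≤ 3 * (|l i| ^ k * |z i|)) ∧
    (∀ k ≤ N, (bumpSaddle l i)^[k] z ∈ ball (0 : EuclideanSpace ℝ (Fin 2)) R) ∧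
    (∀ k < N, |l i| ^ N * |z i| * diagonalBump ((bumpSaddle l i)^[k] z)
      ≤ |(bumpSaddle l i)^[N] z i - l i ^ N * z i|) ∧
    φ ((bumpSaddle l i)^[N] z) = l i ^ N * φ z := by
  have hj : ∀ k, |(bumpSaddle l i)^[k] z j| = |l j| ^ k * |z j| := by
    intro k
    induction k with
    | zero => simp
    | succ k ih =>
      rw [Function.iterate_succ_apply', bumpSaddle_apply_of_ne l hij, abs_mul, ih, pow_succ]
      ring
  obtain ⟨hg1, hg2⟩ := perturbed_geometric_bounds (N := N) (ν := l i)
    (w := fun k => (bumpSaddle l i)^[k] z i) (h := fun k => diagonalBump ((bumpSaddle l i)^[k] z))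
    (fun k => by rw [Function.iterate_succ_apply', bumpSaddle_apply_self])
    (fun k => diagonalBump_nonneg _)
    ((Finset.sum_le_sum fun k _ => (diagonalBump_le hij _).trans_eq (hj k)).trans hsum)
  have hball : ∀ k ≤ N, (bumpSaddle l i)^[k] z ∈ ball (0 : EuclideanSpace ℝ (Fin 2)) R := by
    intro k hk
    rw [mem_ball_zero_iff]
    have h1 := norm_le_abs_add_abs hij ((bumpSaddle l i)^[k] z)
    have h2 := (hg1 k hk).2
    have h3 := hx k hk
    have h4 := hy k hk
    rw [hj] at h1
    simp only [Function.iterate_zero, id] at h2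
    linarith
  refine ⟨hj, hg1, hball, hg2, ?_⟩
  have hφ : ∀ k ≤ N, φ ((bumpSaddle l i)^[k] z) = l i ^ k * φ z := by
    intro k
    induction k with
    | zero => simp
    | succ k ih =>
      intro hk
      have h1 := hball (k + 1) hk
      rw [Function.iterate_succ_apply'] at h1 ⊢
      rw [hconj _ (hball k (by omega)) h1, ih (by omega), pow_succ]
      ring
  exact hφ N le_rfl

/-- Along an orbit of length `N` from one axis to the other, the value of `diagonalBump` at any
intermediate point is bounded by the errors of the coordinate estimates at the two ends. -/
theorem diagonalBump_le_of_orbit (hij : i ≠ j) {α κ β R c M C s : ℝ} (hβ : 0 < β) (hα0 : α ≠ 0)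
    (hα : |α| < 1) (hκ : 1 < |κ|) (hcase : (l j = α ∧ l i = κ) ∨ (l j = α⁻¹ ∧ l i = κ⁻¹))
    {φ : EuclideanSpace ℝ (Fin 2) → ℝ} (hC : 0 ≤ C)
    (hconj : ∀ z ∈ ball (0 : EuclideanSpace ℝ (Fin 2)) R,
      bumpSaddle l i z ∈ ball (0 : EuclideanSpace ℝ (Fin 2)) R → φ (bumpSaddle l i z) = l i * φ z)
    (hφ₁ : ∀ z ∈ ball (0 : EuclideanSpace ℝ (Fin 2)) R, |φ z - c * z i| ≤ M * |z j|)
    (hφ₂ : ∀ z ∈ ball (0 : EuclideanSpace ℝ (Fin 2)) R, |φ z - c * z i| ≤ C * |z i| ^ β * |z i|)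
    (hs : 0 < s) (hsR : 4 * s < R) (hsα : s ≤ 1 - |α|) {N m : ℕ} (hm0 : 0 < m) (hmN : m < N) :
    ∃ z : EuclideanSpace ℝ (Fin 2), |z j| = s * |α| ^ m ∧
      s * |κ| ^ m / |κ| ^ N ≤ |z i| ∧ |z i| ≤ 3 * (s * |κ| ^ m / |κ| ^ N) ∧
      |c| * s * diagonalBump z
        ≤ M * (s * |α| ^ N) + C * (3 * (s / |κ| ^ N)) ^ β * (3 * s) := by
  have hκ0 : 0 < |κ| := one_pos.trans hκ
  have hα00 : 0 < |α| := abs_pos.2 hα0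
  have hα1 : 0 < 1 - |α| := sub_pos.2 hα
  have hκN : 0 < |κ| ^ N := by positivity
  have hgeom : ∑ k ∈ Finset.range N, |α| ^ k * s ≤ 1 := by
    rw [← Finset.sum_mul]
    calc _ ≤ (1 - |α|)⁻¹ * (1 - |α|) :=
          mul_le_mul (sum_range_pow_le (abs_nonneg _) hα N) hsα hs.le (by positivity)
      _ = 1 := inv_mul_cancel₀ hα1.ne'
  rcases hcase with ⟨hj, hi⟩ | ⟨hj, hi⟩
  · -- The orbit leaves along the `i`-axis, from `(s / |κ| ^ N, s)`.
    set z := planePoint i j (s / |κ| ^ N) s with hz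
    have hzi : |z i| = s / |κ| ^ N := by
      rw [hz, planePoint_apply_left hij, abs_of_pos (by positivity)]
    have hzj : |z j| = s := by rw [hz, planePoint_apply_right hij, abs_of_pos hs]
    obtain ⟨o1, o2, o3, o4, o5⟩ := bumpSaddle_orbit (l := l) (z := z) (N := N) (s := s) hij
      (by rw [hj, hzj]; exact hgeom)
      (fun k _ => by
        rw [hj, hzj]
        exact mul_le_of_le_one_left hs.le (pow_le_one₀ (abs_nonneg _) hα.le))
      (fun k hk => by
        rw [hi, hzi, ← mul_div_assoc, div_le_iff₀ hκN, mul_comm]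
        exact mul_le_mul_of_nonneg_left (pow_le_pow_right₀ hκ.le hk) hs.le) hsR hconj
    rw [hi] at o2 o4 o5
    rw [hj] at o1
    rw [hzj] at o1
    rw [hzi] at o2 o4
    refine ⟨(bumpSaddle l i)^[m] z, by rw [o1]; ring, ?_, ?_, ?_⟩
    · exact (by ring : s * |κ| ^ m / |κ| ^ N = |κ| ^ m * (s / |κ| ^ N)).trans_le (o2 m hmN.le).1
    · exact (o2 m hmN.le).2.trans_eq (by ring)
    · have h1 := o4 m hmN
      rw [mul_div_cancel₀ _ hκN.ne'] at h1
      have h2 := hφ₁ _ (o3 N le_rfl)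
      have h3 := hφ₂ _ (o3 0 (Nat.zero_le _))
      rw [o5, o1] at h2
      rw [Function.iterate_zero, id, hzi] at h3
      have h4 : |κ ^ N * (φ z - c * z i)| ≤ C * (s / |κ| ^ N) ^ β * s := by
        rw [abs_mul, abs_pow]
        refine (mul_le_mul_of_nonneg_left h3 hκN.le).trans_eq ?_
        field_simp
      have h5 : c * ((bumpSaddle l i)^[N] z i - κ ^ N * z i)
          = κ ^ N * (φ z - c * z i) - (κ ^ N * φ z - c * (bumpSaddle l i)^[N] z i) := by ring
      have h6 : |c| * |(bumpSaddle l i)^[N] z i - κ ^ N * z i|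
          ≤ C * (s / |κ| ^ N) ^ β * s + M * (|α| ^ N * s) := by
        rw [← abs_mul, h5]
        exact (abs_sub _ _).trans (add_le_add h4 h2)
      have h7 : (s / |κ| ^ N) ^ β ≤ (3 * (s / |κ| ^ N)) ^ β :=
        Real.rpow_le_rpow (by positivity) (by linarith [show 0 < s / |κ| ^ N by positivity]) hβ.le
      calc |c| * s * diagonalBump ((bumpSaddle l i)^[m] z)
          = |c| * (s * diagonalBump ((bumpSaddle l i)^[m] z)) := by ring
        _ ≤ C * (s / |κ| ^ N) ^ β * s + M * (|α| ^ N * s) :=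
            (mul_le_mul_of_nonneg_left h1 (abs_nonneg c)).trans h6
        _ ≤ C * (3 * (s / |κ| ^ N)) ^ β * (3 * s) + M * (|α| ^ N * s) := by
            gcongr; linarith
        _ = _ := by ring
  · -- The orbit arrives along the `i`-axis, from `(s, s * |α| ^ N)`.
    set z := planePoint i j s (s * |α| ^ N) with hz
    have hzi : |z i| = s := by rw [hz, planePoint_apply_left hij, abs_of_pos hs]
    have hzj : |z j| = s * |α| ^ N := by
      rw [hz, planePoint_apply_right hij, abs_of_pos (by positivity)]
    have hback : ∀ k ≤ N, |α⁻¹| ^ k * (s * |α| ^ N) = |α| ^ (N - k) * s := by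
      intro k hk
      rw [abs_inv, ← Nat.sub_add_cancel hk, Nat.add_sub_cancel, pow_add, inv_pow]
      field_simp
    have hκback : ∀ k ≤ N, |κ⁻¹| ^ k * s = s * |κ| ^ (N - k) / |κ| ^ N := by
      intro k hk
      rw [abs_inv, inv_pow, ← Nat.sub_add_cancel hk, Nat.add_sub_cancel, pow_add]
      field_simp
    obtain ⟨o1, o2, o3, o4, o5⟩ := bumpSaddle_orbit (l := l) (z := z) (N := N) (s := s) hij
      (by
        rw [hj, hzj, ← Finset.sum_range_reflect]
        refine (Finset.sum_le_sum fun k hk => ?_).trans hgeom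
        have hk' := Finset.mem_range.1 hk
        rw [hback _ (by omega)]
        exact mul_le_mul_of_nonneg_right
          (pow_le_pow_of_le_one (abs_nonneg _) hα.le (by omega)) hs.le)
      (fun k hk => by
        rw [hj, hzj, hback k hk]
        exact mul_le_of_le_one_left hs.le (pow_le_one₀ (abs_nonneg _) hα.le))
      (fun k hk => by
        rw [hi, hzi, abs_inv, inv_pow]
        exact mul_le_of_le_one_left hs.le (inv_le_one_of_one_le₀ (one_le_pow₀ hκ.le))) hsR hconj
    rw [hi] at o2 o4 o5
    rw [hj] at o1
    rw [hzj] at o1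
    rw [hzi] at o2 o4
    have hNm : N - (N - m) = m := by omega
    have hm' : N - m ≤ N := by omega
    refine ⟨(bumpSaddle l i)^[N - m] z, ?_, ?_, ?_, ?_⟩
    · rw [o1, hback _ hm', hNm, mul_comm]
    · have h1 := (o2 _ hm').1
      rwa [hκback _ hm', hNm] at h1
    · have h1 := (o2 _ hm').2
      rwa [hκback _ hm', hNm] at h1
    · have hκN' : |κ⁻¹| ^ N = (|κ| ^ N)⁻¹ := by rw [abs_inv, inv_pow]
      have h1 := o4 (N - m) (by omega)
      have h2 := hφ₁ _ (o3 0 (Nat.zero_le _))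
      have h3 := hφ₂ _ (o3 N le_rfl)
      have h4 := (o2 N le_rfl).2
      rw [Function.iterate_zero, id, hzj] at h2
      rw [o5] at h3
      rw [hκN'] at h1 h4
      have h4' : |(bumpSaddle l i)^[N] z i| ≤ 3 * (s / |κ| ^ N) := h4.trans_eq (by ring)
      have h3' : |κ⁻¹ ^ N * φ z - c * (bumpSaddle l i)^[N] z i|
          ≤ C * (3 * (s / |κ| ^ N)) ^ β * (3 * (s / |κ| ^ N)) :=
        h3.trans (mul_le_mul (mul_le_mul_of_nonneg_left
          (Real.rpow_le_rpow (abs_nonneg _) h4' hβ.le) hC) h4' (abs_nonneg _) (by positivity))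
      have h2' : |κ⁻¹ ^ N * (φ z - c * z i)| ≤ (|κ| ^ N)⁻¹ * (M * (s * |α| ^ N)) := by
        rw [abs_mul, abs_pow, hκN']
        exact mul_le_mul_of_nonneg_left h2 (by positivity)
      have h5 : c * ((bumpSaddle l i)^[N] z i - κ⁻¹ ^ N * z i)
          = κ⁻¹ ^ N * (φ z - c * z i) - (κ⁻¹ ^ N * φ z - c * (bumpSaddle l i)^[N] z i) := by ring
      have h6 : |c| * |(bumpSaddle l i)^[N] z i - κ⁻¹ ^ N * z i|
          ≤ (|κ| ^ N)⁻¹ * (M * (s * |α| ^ N))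
            + C * (3 * (s / |κ| ^ N)) ^ β * (3 * (s / |κ| ^ N)) := by
        rw [← abs_mul, h5]
        exact (abs_sub _ _).trans (add_le_add h2' h3')
      have h7 := (mul_le_mul_of_nonneg_left h1 (abs_nonneg c)).trans h6
      calc |c| * s * diagonalBump ((bumpSaddle l i)^[N - m] z)
          = |κ| ^ N * (|c| * ((|κ| ^ N)⁻¹ * s * diagonalBump ((bumpSaddle l i)^[N - m] z))) := by
            field_simp
        _ ≤ |κ| ^ N * ((|κ| ^ N)⁻¹ * (M * (s * |α| ^ N))
            + C * (3 * (s / |κ| ^ N)) ^ β * (3 * (s / |κ| ^ N))) :=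
            mul_le_mul_of_nonneg_left h7 hκN.le
        _ = _ := by field_simp

/-- The saddle `bumpSaddle l i` has no `C^{1,β}` linearization for
`β > log |α| / (log |α| - log |κ|)`. The orbit estimate is applied at the point where the two
coordinates are of the same size `exp (-(a b / (a + b)) N)`, with `a = -log |α|`, `b = log |κ|`. -/
theorem not_isC1HolderLinearizable_bumpSaddle (hij : i ≠ j) {α κ β : ℝ} (hα0 : α ≠ 0)
    (hα : |α| < 1) (hκ : 1 < |κ|) (hcase : (l j = α ∧ l i = κ) ∨ (l j = α⁻¹ ∧ l i = κ⁻¹))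
    (hβ : Real.log |α| / (Real.log |α| - Real.log |κ|) < β) :
    ¬ IsC1HolderLinearizable β (bumpSaddle l i) := by
  intro hlin
  set a := -Real.log |α| with ha
  set b := Real.log |κ| with hb
  have hα00 : 0 < |α| := abs_pos.2 hα0
  have hκ0 : 0 < |κ| := one_pos.trans hκ
  have ha0 : 0 < a := neg_pos.2 (Real.log_neg hα00 hα)
  have hb0 : 0 < b := Real.log_pos hκ
  have hab : 0 < a + b := add_pos ha0 hb0
  have hβ' : a / (a + b) < β := by
    refine lt_of_eq_of_lt ?_ hβ
    rw [← neg_div_neg_eq, ha, neg_neg]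
    congr 1
    ring
  have hβ0 : 0 < β := lt_trans (by positivity) hβ'
  have hαe : ∀ k : ℕ, |α| ^ k = Real.exp (-(a * k)) := by
    intro k
    rw [← Real.exp_log hα00, ← Real.exp_nat_mul, ha]
    ring_nf
  have hκe : ∀ k : ℕ, |κ| ^ k = Real.exp (b * k) := by
    intro k
    rw [← Real.exp_log hκ0, ← Real.exp_nat_mul, ← hb]
    ring_nf
  have hF0 : HasFDerivAt (bumpSaddle l i)
      (Matrix.toEuclideanCLM (n := Fin 2) (𝕜 := ℝ) (Matrix.diagonal l)) 0 :=
    hasFDerivAt_bumpSaddle_of_apply_eq_zero l hij (by simp)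
  obtain ⟨φ, hφ, hφ0, R₀, hR₀, hconj₀⟩ := hlin.exists_coordinate (i := i) hβ0 hF0
  obtain ⟨R, hR, c, hc, M, hM, C, hC, hconj, hφ₁, hφ₂⟩ :=
    coordinate_estimates hij hβ0 hα0 hα hκ hcase hφ hφ0 hR₀ hconj₀
  obtain ⟨s, hs, hsR, hsα⟩ : ∃ s > 0, 4 * s < R ∧ s ≤ 1 - |α| := by
    have h1 : 0 < 1 - |α| := sub_pos.2 hα
    refine ⟨min (R / 8) (1 - |α|), by positivity, ?_, min_le_right _ _⟩
    have := min_le_left (R / 8) (1 - |α|)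
    linarith
  set q := a * b / (a + b) with hq
  have hqa : q < a := by
    rw [hq, div_lt_iff₀ hab]; nlinarith
  have hqb : q < b * β := by
    calc q = b * (a / (a + b)) := by rw [hq]; ring
      _ < b * β := mul_lt_mul_of_pos_left hβ' hb0
  set B := 3 * Real.exp (a + b) with hB
  have hB0 : 0 < B := by positivity
  refine not_forall_exp_le (q := q) (a := a) (b := b * β)
    (c := |c| * s * (s * Real.exp (-a) / (8 * B ^ 3))) (C := M * s)
    (D := C * (3 * s) ^ β * (3 * s)) (by have := abs_pos.2 hc; positivity) hqa hqb ?_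
  have hlarge : ∀ᶠ N : ℕ in atTop, 1 < (N : ℝ) * (a / (a + b)) :=
    (tendsto_natCast_atTop_atTop.atTop_mul_const (by positivity)).eventually_gt_atTop 1
  filter_upwards [hlarge, eventually_gt_atTop 0] with N hN hN0
  have hN0' : (0 : ℝ) < N := Nat.cast_pos.2 hN0
  -- The time at which the two coordinates are comparable.
  set x := (N : ℝ) * (b / (a + b)) with hx
  have hx0 : 0 < x := by positivity
  have hxN : (N : ℝ) - x = N * (a / (a + b)) := by rw [hx]; field_simp; ring
  set m := ⌈x⌉₊ with hm
  have hm0 : 0 < m := Nat.ceil_pos.2 hx0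
  have hm1 : x ≤ m := Nat.le_ceil x
  have hm2 : (m : ℝ) < x + 1 := Nat.ceil_lt_add_one hx0.le
  have hmN : m < N := by
    have : (m : ℝ) < N := by linarith
    exact_mod_cast this
  have hax : a * x = q * N := by rw [hx, hq]; ring
  have hbx : b * (N - x) = q * N := by rw [hxN, hq]; ring
  have ham : q * N ≤ a * m := hax ▸ mul_le_mul_of_nonneg_left hm1 ha0.le
  have ham' : a * m ≤ q * N + a := by
    have := mul_le_mul_of_nonneg_left hm2.le ha0.le
    rwa [mul_add, hax, mul_one] at this
  have hbm : b * (N - m) ≤ q * N :=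
    hbx ▸ mul_le_mul_of_nonneg_left (sub_le_sub_left hm1 _) hb0.le
  have hbm' : q * N ≤ b * (N - m) + b := by
    have := mul_le_mul_of_nonneg_left (show (N : ℝ) - x ≤ N - m + 1 by linarith) hb0.le
    rwa [hbx, mul_add, mul_one] at this
  obtain ⟨z, hzj, hzi1, hzi2, hz⟩ := diagonalBump_le_of_orbit hij hβ0 hα0 hα hκ hcase hC hconj hφ₁
    hφ₂ hs hsR hsα hm0 hmN
  have hquot : s * |κ| ^ m / |κ| ^ N = s * Real.exp (-(b * (N - m))) := by
    rw [hκe, hκe, mul_div_assoc, ← Real.exp_sub]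
    ring_nf
  rw [hαe] at hzj
  rw [hquot] at hzi1 hzi2
  set t := s * Real.exp (-a) * Real.exp (-(q * N)) with ht
  have ht0 : 0 < t := by positivity
  have ht' : t = s * Real.exp (-a + -(q * N)) := by rw [ht, Real.exp_add]; ring
  have hBt : B * t = 3 * (s * Real.exp (b + -(q * N))) := by
    rw [ht', hB]
    have : Real.exp (b + -(q * N)) = Real.exp (a + b) * Real.exp (-a + -(q * N)) := by
      rw [← Real.exp_add]; ring_nf
    rw [this]; ring
  have h1 : t ≤ |z j| := by
    rw [hzj, ht']
    exact mul_le_mul_of_nonneg_left (Real.exp_le_exp.2 (by linarith)) hs.le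
  have h2 : t ≤ |z i| := by
    refine le_trans ?_ hzi1
    rw [ht']
    exact mul_le_mul_of_nonneg_left (Real.exp_le_exp.2 (by linarith)) hs.le
  have h3 : |z j| ≤ B * t := by
    have h : s * Real.exp (-(a * m)) ≤ s * Real.exp (b + -(q * N)) :=
      mul_le_mul_of_nonneg_left (Real.exp_le_exp.2 (by linarith)) hs.le
    have h' : 0 ≤ s * Real.exp (b + -(q * N)) := by positivity
    rw [hzj, hBt]
    linarith
  have h4 : |z i| ≤ B * t := by
    refine hzi2.trans ?_
    rw [hBt]
    exact mul_le_mul_of_nonneg_left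
      (mul_le_mul_of_nonneg_left (Real.exp_le_exp.2 (by linarith)) hs.le) (by norm_num)
  have h5 := le_diagonalBump hij ht0 hB0 h2 h1 h4 h3
  have h6 : (3 * (s / |κ| ^ N)) ^ β = (3 * s) ^ β * Real.exp (-(b * β * N)) := by
    rw [hκe, ← mul_div_assoc, div_eq_mul_inv, ← Real.exp_neg,
      Real.mul_rpow (by positivity) (Real.exp_pos _).le, ← Real.exp_mul]
    ring_nf
  rw [h6, hαe] at hz
  calc |c| * s * (s * Real.exp (-a) / (8 * B ^ 3)) * Real.exp (-(q * N))
      = |c| * s * (t / (8 * B ^ 3)) := by rw [ht]; ring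
    _ ≤ |c| * s * diagonalBump z := mul_le_mul_of_nonneg_left h5 (by positivity)
    _ ≤ _ := hz
    _ = _ := by ring

theorem isPlanarC11WithDiag_bumpSaddle (hij : i ≠ j) (l₁ l₂ : ℝ) :
    IsPlanarC11WithDiag l₁ l₂ (bumpSaddle ![l₁, l₂] i) :=
  ⟨isC1HolderOn_bumpSaddle _ hij, bumpSaddle_zero _ i,
    hasFDerivAt_bumpSaddle_of_apply_eq_zero _ hij (by simp)⟩

end Sharpness

theorem corollary2 (l₁ l₂ : ℝ) (h₁ : 0 < |l₁|) (h₁' : |l₁| < 1) (h₂ : 1 < |l₂|) :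
    -- every such map is `C^{1,β}` linearizable with `β = saddleExponent l₁ l₂ - ε`
    (∀ F : EuclideanSpace ℝ (Fin 2) → EuclideanSpace ℝ (Fin 2),
      IsPlanarC11WithDiag l₁ l₂ F →
      ∀ ε : ℝ, 0 < ε → ε < saddleExponent l₁ l₂ →
        saddleExponent l₁ l₂ - ε ∈ Set.Ioc (0 : ℝ) 1 ∧
        IsC1HolderLinearizable (saddleExponent l₁ l₂ - ε) F) ∧
    -- sharpness: no larger exponent works for all such maps
    (0 < saddleExponent l₁ l₂ ∧
      ∃ F : EuclideanSpace ℝ (Fin 2) → EuclideanSpace ℝ (Fin 2),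
        IsPlanarC11WithDiag l₁ l₂ F ∧
        ∀ β : ℝ, saddleExponent l₁ l₂ < β → β ≤ 1 → ¬ IsC1HolderLinearizable β F) := by
  have hpos := saddleExponent_pos h₁ h₁' h₂
  refine ⟨fun F hF ε hε hε' => ⟨⟨by linarith, ?_⟩, ?_⟩, hpos, ?_⟩
  · linarith [saddleExponent_le_one h₁ h₁' h₂]
  · exact isC1HolderLinearizable_of_lt_saddleExponent h₁ h₁' h₂ (by linarith) (by linarith) hF
  · have hl₁ : l₁ ≠ 0 := abs_pos.1 h₁
    have hl₂ : l₂ ≠ 0 := abs_pos.1 (one_pos.trans h₂)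
    -- The coordinate that carries the obstruction is the one that determines the minimum.
    rcases min_choice (Real.log |l₁| / (Real.log |l₁| - Real.log |l₂|))
      (Real.log |l₂| / (Real.log |l₂| - Real.log |l₁|)) with h | h
    · refine ⟨bumpSaddle ![l₁, l₂] 1, isPlanarC11WithDiag_bumpSaddle one_ne_zero l₁ l₂,
        fun β hβ _ => ?_⟩
      refine not_isC1HolderLinearizable_bumpSaddle (i := 1) (j := 0) one_ne_zero hl₁ h₁' h₂
        (Or.inl ⟨by simp, by simp⟩) ?_
      rwa [saddleExponent, h] at hβ
    · refine ⟨bumpSaddle ![l₁, l₂] 0, isPlanarC11WithDiag_bumpSaddle zero_ne_one l₁ l₂,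
        fun β hβ _ => ?_⟩
      refine not_isC1HolderLinearizable_bumpSaddle (i := 0) (j := 1) (α := l₂⁻¹) (κ := l₁⁻¹)
        zero_ne_one (inv_ne_zero hl₂) (by rw [abs_inv]; exact inv_lt_one_of_one_lt₀ h₂)
        (by rw [abs_inv]; exact (one_lt_inv₀ h₁).2 h₁') (Or.inr ⟨by simp, by simp⟩) ?_
      rw [saddleExponent, h] at hβ
      rw [abs_inv, abs_inv, Real.log_inv, Real.log_inv, sub_neg_eq_add, neg_add_eq_sub, ← neg_sub,
        neg_div_neg_eq]
      exact hβ
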